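/- Let $\Bbbk$ be an algebraically closed field. Let $(H,R)$ be a finite-dimensional quasitriangular Hopf algebra over $\Bbbk$, that is, $R=R_i\otimes R^i\in H\otimes H$ (summation understood) is invertible with $$(\Delta\otimes\mathrm{id})(R)=R_{13}R_{23},\qquad (\mathrm{id}\otimes\Delta)(R)=R_{13}R_{12},\qquad R\,\Delta(h)=\Delta^{\mathrm{op}}(h)\,R\quad(h\in H).$$ Let $(B,K)$ be a finite-dimensional quasitriangular left $H$-comodule algebra: $B$ is an algebra with a coassociative counital algebra map $\delta:B\to H\otimes B$, $b\mapsto b_{[-1]}\otimes b_{[0]}$, and $K=K_i\otimes K^i\in H\otimes B$ is invertible with $$(\Delta\otimes \mathrm{id})(K)=K_{23}R_{21}K_{13}R_{21}^{-1},\qquad (\mathrm{id}\otimes\delta)(K)=R_{21}K_{13}R_{12},\qquad K\,\delta(b)=\delta(b)\,K\quad(b\in B).$$ Let $\mathcal C=H\text{-}\mathsf{FdMod}$ be the braided tensor category of finite-dimensional $H$-modules, with braiding $x\otimes y\mapsto R^i y\otimes R_i x$ and duals $X^*$ (with $\mathrm{ev}_X:X^*\otimes X\to\mathbb 1$ and $\mathrm{coev}_X:\mathbb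 1\to X\otimes X^*$). Let $\mathcal M=B\text{-}\mathsf{FdMod}$ be the left $\mathcal C$-module category with $X\triangleright M=X\otimes_\Bbbk M$, where $b(x\otimes m)=b_{[-1]}x\otimes b_{[0]}m$, braided by $e_{X,M}:X\triangleright M\to X\triangleright M$, $x\otimes m\mapsto K_ix\otimes K^im$. Assume that $\mathcal M$ is exact ($P\triangleright M$ is projective for every projective $P\in\mathcal C$ and every $M\in\mathcal M$) and indecomposable (it is not equivalent, as a $\Bbbk$-linear $\mathcal C$-module category, to a direct sum of two nonzero module categories). Let $\underline{\mathrm{Hom}}(M,N)\in\mathcal C$ be the internal Hom, $\mathrm{Hom}_{\mathcal M}(X\triangleright M,N)\cong\mathrm{Hom}_{\mathcal C}(X,\underline{\mathrm{Hom}}(M,N))$, let $\mathrm{coev}_{\mathbb 1,M}:\mathbb 1\to\underline{\mathrm{Hom}}(M,M)$ correspond to $\mathbb 1\triangleright M\cong M$, and consider the ends, with their projections, $$E_{\mathcal C}=\int_{X\in\mathcal C}X\otimes X^*,\quad \pi_{\mathcal C}(X):E_{\mathcal C}\to X\otimes X^*,\qquad E_{\mathcal M}=\int_{M\in\mathcal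 M}\underline{\mathrm{Hom}}(M,M),\quad \pi_{\mathcal M}(M):E_{\mathcal M}\to\underline{\mathrm{Hom}}(M,M).$$ The universal copairing $\omega_{\mathcal M}:\mathbb 1\to E_{\mathcal C}\otimes E_{\mathcal M}$ is the unique morphism such that, for all $X\in\mathcal C$ and $M\in\mathcal M$, the morphism $(\pi_{\mathcal C}(X)\otimes\pi_{\mathcal M}(M))\,\omega_{\mathcal M}$ is the composite $$\mathbb 1\xrightarrow{\mathrm{coev}_X\otimes\mathrm{coev}_{\mathbb 1,M}}X\otimes X^*\otimes\underline{\mathrm{Hom}}(M,M)\cong X\otimes\underline{\mathrm{Hom}}(M,X^*\triangleright M)\xrightarrow{\mathrm{id}\otimes\underline{\mathrm{Hom}}(\mathrm{id},e_{X^*,M})}X\otimes\underline{\mathrm{Hom}}(M,X^*\triangleright M)\cong X\otimes X^*\otimes\underline{\mathrm{Hom}}(M,M),$$ with the canonical isomorphisms $Y\otimes\underline{\mathrm{Hom}}(M,N)\cong\underline{\mathrm{Hom}}(M,Y\triangleright N)$. The module category $\mathcal M$ is nondegenerate if $$\theta_{\mathcal M}=(\mathrm{ev}_{E_{\mathcal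 C}}\otimes\mathrm{id})(\mathrm{id}\otimes\omega_{\mathcal M}):E_{\mathcal C}^*\to E_{\mathcal M}$$ is an isomorphism. Let $E(H,B)=\{\xi\in\mathrm{Hom}_\Bbbk(H,B) : \xi(b_{[-1]}h)\,b_{[0]}=b\,\xi(h)\ \text{for all } b\in B,\ h\in H\}$. The pair $(B,K)$ is factorizable if the linear map $$\theta_B:H^*\to E(H,B),\qquad f\mapsto\bigl[h\mapsto\langle f,S(h_{(1)})K_ih_{(2)}\rangle K^i\bigr]$$ (which does take values in $E(H,B)$) is bijective. Then the braided left $\mathcal C$-module category $\mathcal M=B\text{-}\mathsf{FdMod}$ is nondegenerate if and only if $(B,K)$ is factorizable. -/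

import Mathlib

open CategoryTheory MonoidalCategory TensorProduct

set_option linter.unusedVariables false
set_option linter.unusedSimpArgs false
set_option linter.unusedSectionVars false

universe v₁ v₂ u₁ u₂ u

/-! ### Braided module categories, internal Homs and nondegeneracy -/

namespace CategoryTheory

open MonoidalLeftAction Limits Opposite

section General

variable (C : Type u₁) [Category.{v₁} C] [MonoidalCategory C]
variable (M : Type u₂) [Category.{v₂} M]

/-- A braiding `e` on a left module category `M` over a braided monoidal category `C`. -/
class BraidedLeftModuleCategory [BraidedCategory C] [MonoidalLeftAction C M] where
  e (X : C) (m : M) : X ⊙ₗ m ≅ X ⊙ₗ m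
  e_naturality {X Y : C} {m n : M} (f : X ⟶ Y) (g : m ⟶ n) :
    (e X m).hom ≫ (f ⊙ₗₘ g) = (f ⊙ₗₘ g) ≫ (e Y n).hom
  e_tensor (X Y : C) (m : M) :
    (e (X ⊗ Y) m).hom =
      (β_ Y X).inv ⊵ₗ m ≫ (αₗ Y X m).hom ≫ Y ⊴ₗ (e X m).hom ≫ (αₗ Y X m).inv ≫
        (β_ Y X).hom ⊵ₗ m ≫ (αₗ X Y m).hom ≫ X ⊴ₗ (e Y m).hom ≫ (αₗ X Y m).inv
  e_action (X Y : C) (m : M) :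
    (e X (Y ⊙ₗ m)).hom =
      (αₗ X Y m).inv ≫ (β_ X Y).hom ⊵ₗ m ≫ (αₗ Y X m).hom ≫ Y ⊴ₗ (e X m).hom ≫
        (αₗ Y X m).inv ≫ (β_ Y X).hom ⊵ₗ m ≫ (αₗ X Y m).hom

/-- A left `C`-module category is exact if `P ⊙ₗ m` is projective for each projective `P : C`. -/
def IsExactModuleCategory [MonoidalLeftAction C M] : Prop :=
  ∀ (P : C) [Projective P] (m : M), Projective (P ⊙ₗ m)

/-- A `k`-linear left `C`-module category is indecomposable if, whenever it is equivalent as a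
module category to a direct sum `M₁ ⊕ M₂` (the product category with componentwise action), one
of `M₁`, `M₂` is zero. A module functor to `M₁ ⊕ M₂` is a pair of module functors. -/
def IsIndecomposableModuleCategory (k : Type u) [Field k] [MonoidalLeftAction C M]
    [Preadditive M] [Linear k M] : Prop :=
  ∀ (M₁ M₂ : Type u₂) [Category.{v₂} M₁] [Category.{v₂} M₂] [Abelian M₁] [Abelian M₂]
    [Linear k M₁] [Linear k M₂] [MonoidalLeftAction C M₁] [MonoidalLeftAction C M₂]
    (F₁ : M ⥤ M₁) (F₂ : M ⥤ M₂) [F₁.Additive] [F₂.Additive] [F₁.Linear k] [F₂.Linear k]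
    [F₁.LeftLinear C] [F₂.LeftLinear C], (F₁.prod' F₂).IsEquivalence →
    (∀ m : M₁, IsZero m) ∨ (∀ m : M₂, IsZero m)

/-- Internal Homs of a left `C`-module category: a bifunctor `(m, n) ↦ Hom(m, n)` together with
bijections `Hom_M (X ⊙ₗ m, n) ≃ Hom_C (X, Hom(m, n))` natural in `m`, `X` and `n`. -/
structure InternalHoms [MonoidalLeftAction C M] where
  hom : Mᵒᵖ ⥤ M ⥤ C
  adj : (curriedAction C M).flip ⊣₂ hom

variable {C M}

namespace InternalHoms

variable [MonoidalLeftAction C M] (I : InternalHoms C M)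

/-- The object `Hom(m, n)`. -/
abbrev obj (m n : M) : C := (I.hom.obj (op m)).obj n

/-- The bijection `Hom_M (X ⊙ₗ m, n) ≃ Hom_C (X, Hom(m, n))`. -/
def zeta (X : C) (m n : M) : (X ⊙ₗ m ⟶ n) ≃ (X ⟶ I.obj m n) :=
  (I.adj.adj m).homEquiv X n

/-- `coev_{𝟙, m} : 𝟙 ⟶ Hom(m, m)`. -/
def coev (m : M) : 𝟙_ C ⟶ I.obj m m := I.zeta (𝟙_ C) m m (λₗ m).hom

/-- `ev_{m, n} : Hom(m, n) ⊙ₗ m ⟶ n`. -/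
def ev (m n : M) : I.obj m n ⊙ₗ m ⟶ n := (I.zeta (I.obj m n) m n).symm (𝟙 _)

/-- The canonical morphism `X ⊗ Hom(m, n) ⟶ Hom(m, X ⊙ₗ n)`;
it is invertible when `X` has a dual. -/
def tensorComparison (X : C) (m n : M) : X ⊗ I.obj m n ⟶ I.obj m (X ⊙ₗ n) :=
  I.zeta (X ⊗ I.obj m n) m (X ⊙ₗ n) ((αₗ X (I.obj m n) m).hom ≫ X ⊴ₗ I.ev m n)

end InternalHoms

/-- The bifunctor `(X, Y) ↦ Y ⊗ X^*`, where `X^*` is the dual with `ev : X^* ⊗ X ⟶ 𝟙` and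
`coev : 𝟙 ⟶ X ⊗ X^*` (denoted `Xᘁ` in Mathlib). -/
@[simps]
def tensorDual (C : Type u₁) [Category.{v₁} C] [MonoidalCategory C] [RightRigidCategory C] :
    Cᵒᵖ ⥤ C ⥤ C where
  obj X :=
    { obj := fun Y => Y ⊗ (unop X)ᘁ
      map := fun f => f ▷ (unop X)ᘁ }
  map f := { app := fun Y => Y ◁ (f.unop)ᘁ
             naturality := fun _ _ _ => whisker_exchange _ _ |>.symm }
  map_id X := by ext; simp
  map_comp f g := by ext; simp [comp_rightAdjointMate]

variable [RightRigidCategory C] [BraidedCategory C] [MonoidalLeftAction C M]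
  [BraidedLeftModuleCategory C M]

/-- The property that determines the universal copairing `ω : 𝟙 ⟶ E_C ⊗ E_M`, for wedges
`E_C` over `X ⊗ X^*` and `E_M` over `Hom(m, m)`: for all `X` and `m`, the composite
`𝟙 ⟶ E_C ⊗ E_M ⟶ X ⊗ X^* ⊗ Hom(m, m) ≅ X ⊗ Hom(m, X^* ⊙ₗ m)` is equal to
`𝟙 ⟶ X ⊗ X^* ⊗ Hom(m, m) ≅ X ⊗ Hom(m, X^* ⊙ₗ m) ⟶ X ⊗ Hom(m, X^* ⊙ₗ m)`,
the first arrow being `coev ⊗ coev` and the last one induced by the braiding `e`. -/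
def IsUniversalCopairing (I : InternalHoms C M) (EC : Wedge (tensorDual C)) (EM : Wedge I.hom)
    (ω : 𝟙_ C ⟶ EC.pt ⊗ EM.pt) : Prop :=
  ∀ (X : C) (m : M),
    ω ≫ (EC.ι X ⊗ₘ EM.ι m) ≫ (α_ X Xᘁ (I.obj m m)).hom ≫ X ◁ I.tensorComparison Xᘁ m m =
      (λ_ (𝟙_ C)).inv ≫ (η_ X Xᘁ ⊗ₘ I.coev m) ≫ (α_ X Xᘁ (I.obj m m)).hom ≫
        X ◁ I.tensorComparison Xᘁ m m ≫
          X ◁ (I.hom.obj (op m)).map (BraidedLeftModuleCategory.e Xᘁ m).hom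

/-- The morphism `E^* ⟶ E'` associated with a copairing `ω : 𝟙 ⟶ E ⊗ E'`. -/
def copairingMap {E E' : C} (ω : 𝟙_ C ⟶ E ⊗ E') : Eᘁ ⟶ E' :=
  (ρ_ Eᘁ).inv ≫ Eᘁ ◁ ω ≫ (α_ Eᘁ E E').inv ≫ ε_ E Eᘁ ▷ E' ≫ (λ_ E').hom

variable (C M) in
/-- A braided left `C`-module category `M` is nondegenerate if, for the ends
`E_C = ∫ X ⊗ X^*` and `E_M = ∫ Hom(m, m)` and their universal copairing `ω`, the morphism
`θ_M : E_C^* ⟶ E_M` associated with `ω` is an isomorphism. The internal Homs, the two ends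
and `ω` are determined up to unique isomorphism by their universal properties. -/
def IsNondegenerateModuleCategory : Prop :=
  ∃ (I : InternalHoms C M) (EC : Wedge (tensorDual C)) (EM : Wedge I.hom)
    (_ : IsLimit EC) (_ : IsLimit EM) (ω : 𝟙_ C ⟶ EC.pt ⊗ EM.pt),
    IsUniversalCopairing I EC EM ω ∧ IsIso (copairingMap ω)

end General

end CategoryTheory

/-! ### Finite-dimensional modules over an algebra -/

/-- A finite-dimensional module over a `k`-algebra `A`, given by its structure map. -/
structure FdMod (k : Type u) [Field k] (A : Type u) [Ring A] [Algebra k A] where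
  carrier : Type u
  [addCommGroup : AddCommGroup carrier]
  [module : Module k carrier]
  [finite : FiniteDimensional k carrier]
  ρ : A →ₐ[k] Module.End k carrier

namespace FdMod

section Basic

variable {k : Type u} [Field k] {A : Type u} [Ring A] [Algebra k A]

instance : CoeSort (FdMod k A) (Type u) := ⟨FdMod.carrier⟩

attribute [instance] FdMod.addCommGroup FdMod.module FdMod.finite

/-- A morphism of modules: a `k`-linear map commuting with the action of `A`. -/
@[ext]
structure Hom (X Y : FdMod k A) where
  hom : X →ₗ[k] Y
  comm : ∀ a, hom ∘ₗ X.ρ a = Y.ρ a ∘ₗ hom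

instance : Category (FdMod k A) where
  Hom := Hom
  id X := ⟨LinearMap.id, fun _ => rfl⟩
  comp f g := ⟨g.hom ∘ₗ f.hom, fun a => by
    rw [LinearMap.comp_assoc, f.comm, ← LinearMap.comp_assoc, g.comm, LinearMap.comp_assoc]⟩

@[ext]
lemma hom_ext {X Y : FdMod k A} {f g : X ⟶ Y} (h : f.hom = g.hom) : f = g := Hom.ext h

@[simp] lemma id_hom (X : FdMod k A) : Hom.hom (𝟙 X) = LinearMap.id := rfl

@[simp] lemma comp_hom {X Y Z : FdMod k A} (f : X ⟶ Y) (g : Y ⟶ Z) :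
    (f ≫ g).hom = g.hom ∘ₗ f.hom := rfl

lemma comm_apply {X Y : FdMod k A} (f : X ⟶ Y) (a : A) (x : X) :
    f.hom (X.ρ a x) = Y.ρ a (f.hom x) := LinearMap.congr_fun (f.comm a) x

/-- An isomorphism of modules from a linear equivalence commuting with the action. -/
@[simps]
def mkIso {X Y : FdMod k A} (f : X ≃ₗ[k] Y)
    (h : ∀ a, f.toLinearMap ∘ₗ X.ρ a = Y.ρ a ∘ₗ f.toLinearMap) : X ≅ Y where
  hom := ⟨f.toLinearMap, h⟩
  inv := ⟨f.symm.toLinearMap, fun a => by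
    ext y
    obtain ⟨x, rfl⟩ := f.surjective y
    have := LinearMap.congr_fun (h a) x
    simp only [LinearMap.comp_apply, LinearEquiv.coe_coe, LinearEquiv.symm_apply_apply] at this ⊢
    rw [← this, LinearEquiv.symm_apply_apply]⟩
  hom_inv_id := by ext; simp
  inv_hom_id := by ext; simp

variable (X Y : FdMod k A)

instance : Zero (X ⟶ Y) := ⟨⟨0, fun _ => by simp⟩⟩
instance : Add (X ⟶ Y) :=
  ⟨fun f g => ⟨f.hom + g.hom, fun a => by
    rw [LinearMap.add_comp, LinearMap.comp_add, f.comm, g.comm]⟩⟩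
instance : Neg (X ⟶ Y) :=
  ⟨fun f => ⟨-f.hom, fun a => by rw [LinearMap.neg_comp, LinearMap.comp_neg, f.comm]⟩⟩
instance : Sub (X ⟶ Y) :=
  ⟨fun f g => ⟨f.hom - g.hom, fun a => by
    rw [LinearMap.sub_comp, LinearMap.comp_sub, f.comm, g.comm]⟩⟩
instance : SMul k (X ⟶ Y) :=
  ⟨fun c f => ⟨c • f.hom, fun a => by rw [LinearMap.smul_comp, LinearMap.comp_smul, f.comm]⟩⟩

instance : SMul ℕ (X ⟶ Y) :=
  ⟨fun c f => ⟨c • f.hom, fun a => by rw [LinearMap.smul_comp, LinearMap.comp_smul, f.comm]⟩⟩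
instance : SMul ℤ (X ⟶ Y) :=
  ⟨fun c f => ⟨c • f.hom, fun a => by rw [LinearMap.smul_comp, LinearMap.comp_smul, f.comm]⟩⟩

lemma hom_injective : Function.Injective (fun f : X ⟶ Y => f.hom) := fun _ _ h => hom_ext h

instance : AddCommGroup (X ⟶ Y) :=
  (hom_injective X Y).addCommGroup _ rfl (fun _ _ => rfl) (fun _ => rfl) (fun _ _ => rfl)
    (fun _ _ => rfl) (fun _ _ => rfl)

instance : Module k (X ⟶ Y) :=
  Function.Injective.module k (⟨⟨fun f : X ⟶ Y => f.hom, rfl⟩, fun _ _ => rfl⟩ :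
    (X ⟶ Y) →+ (X →ₗ[k] Y)) (hom_injective X Y) (fun _ _ => rfl)

@[simp] lemma add_hom {X Y : FdMod k A} (f g : X ⟶ Y) : (f + g).hom = f.hom + g.hom := rfl

@[simp] lemma smul_hom {X Y : FdMod k A} (c : k) (f : X ⟶ Y) : (c • f).hom = c • f.hom := rfl

instance : Preadditive (FdMod k A) where
  add_comp _ _ _ f f' g := by ext; simp
  comp_add _ _ _ f g g' := by ext; simp

instance : Linear k (FdMod k A) where
  smul_comp _ _ _ c f g := by ext; simp
  comp_smul _ _ _ f c g := by ext; simp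

end Basic

section Outer

variable {k : Type u} [Field k] {A B D : Type u} [Ring A] [Algebra k A] [Ring B] [Algebra k B]
  [Ring D] [Algebra k D]
  {V W U : Type u} [AddCommGroup V] [Module k V] [AddCommGroup W] [Module k W]
  [AddCommGroup U] [Module k U]

/-- The action of `A ⊗ B` on `V ⊗ W` for actions `ρ` of `A` on `V` and `σ` of `B` on `W`. -/
noncomputable def outer (ρ : A →ₐ[k] Module.End k V) (σ : B →ₐ[k] Module.End k W) :
    A ⊗[k] B →ₐ[k] Module.End k (V ⊗[k] W) :=
  Module.endTensorEndAlgHom.comp (Algebra.TensorProduct.map ρ σ)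

@[simp] lemma outer_tmul (ρ : A →ₐ[k] Module.End k V) (σ : B →ₐ[k] Module.End k W)
    (a : A) (b : B) : outer ρ σ (a ⊗ₜ b) = TensorProduct.map (ρ a) (σ b) := rfl

/-- The `D`-module `X ⊗ Y`, with `D` acting through an algebra map `δ : D → A ⊗ B`. -/
noncomputable def tensorAlong (δ : D →ₐ[k] A ⊗[k] B) (X : FdMod k A) (Y : FdMod k B) :
    FdMod k D where
  carrier := X ⊗[k] Y
  ρ := (outer X.ρ Y.ρ).comp δ

lemma outer_comp_map {X X' : FdMod k A} {Y Y' : FdMod k B} (f : X ⟶ X') (g : Y ⟶ Y')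
    (t : A ⊗[k] B) :
    TensorProduct.map f.hom g.hom ∘ₗ outer X.ρ Y.ρ t =
      outer X'.ρ Y'.ρ t ∘ₗ TensorProduct.map f.hom g.hom := by
  induction t with
  | zero => simp
  | add s t hs ht => rw [map_add, map_add, LinearMap.comp_add, LinearMap.add_comp, hs, ht]
  | tmul a b => simp only [outer_tmul, ← TensorProduct.map_comp, f.comm, g.comm]

/-- The tensor product of two morphisms. -/
noncomputable def tensorAlongMap (δ : D →ₐ[k] A ⊗[k] B) {X X' : FdMod k A} {Y Y' : FdMod k B}
    (f : X ⟶ X') (g : Y ⟶ Y') : tensorAlong δ X Y ⟶ tensorAlong δ X' Y' where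
  hom := TensorProduct.map f.hom g.hom
  comm d := outer_comp_map f g (δ d)

end Outer

end FdMod

/-! ### Comodule algebras, `R`-matrices and `K`-matrices -/

section Algebras

variable (k : Type u) [Field k] (H : Type u) [Ring H]

/-- A left `H`-comodule algebra: an algebra `B` with a coaction `δ : B → H ⊗ B` that is an
algebra map. -/
class LeftComoduleAlgebra [Bialgebra k H] (B : Type u) [Ring B] [Algebra k B] where
  coact : B →ₐ[k] H ⊗[k] B
  coassoc : ∀ b, (Algebra.TensorProduct.assoc k k k H H B)
      (Algebra.TensorProduct.map (Bialgebra.comulAlgHom k H) (AlgHom.id k B) (coact b)) =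
    Algebra.TensorProduct.map (AlgHom.id k H) coact (coact b)
  counit : ∀ b, Algebra.TensorProduct.lid k B
      (Algebra.TensorProduct.map (Bialgebra.counitAlgHom k H) (AlgHom.id k B) (coact b)) = b

variable {k H} {B : Type u} [Ring B] [Algebra k B] [Algebra k H]

/-- `a ⊗ b ↦ a ⊗ b ⊗ 1`. -/
noncomputable def leg12 : H ⊗[k] H →ₐ[k] H ⊗[k] (H ⊗[k] B) :=
  Algebra.TensorProduct.map (AlgHom.id k H) Algebra.TensorProduct.includeLeft

/-- `a ⊗ b ↦ b ⊗ a ⊗ 1`. -/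
noncomputable def leg21 : H ⊗[k] H →ₐ[k] H ⊗[k] (H ⊗[k] B) :=
  leg12.comp (Algebra.TensorProduct.comm k H H).toAlgHom

/-- `a ⊗ b ↦ a ⊗ 1 ⊗ b`. -/
noncomputable def leg13 : H ⊗[k] B →ₐ[k] H ⊗[k] (H ⊗[k] B) :=
  Algebra.TensorProduct.map (AlgHom.id k H) Algebra.TensorProduct.includeRight

/-- `a ⊗ b ↦ 1 ⊗ a ⊗ b`. -/
noncomputable def leg23 : H ⊗[k] B →ₐ[k] H ⊗[k] (H ⊗[k] B) :=
  Algebra.TensorProduct.includeRight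

@[simp] lemma leg12_tmul (a b : H) :
    (leg12 (a ⊗ₜ b) : H ⊗[k] (H ⊗[k] B)) = a ⊗ₜ (b ⊗ₜ 1) := rfl
@[simp] lemma leg21_tmul (a b : H) :
    (leg21 (a ⊗ₜ b) : H ⊗[k] (H ⊗[k] B)) = b ⊗ₜ (a ⊗ₜ 1) := rfl
@[simp] lemma leg13_tmul (a : H) (b : B) :
    (leg13 (a ⊗ₜ b) : H ⊗[k] (H ⊗[k] B)) = a ⊗ₜ (1 ⊗ₜ b) := rfl
@[simp] lemma leg23_apply (t : H ⊗[k] B) :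
    (leg23 t : H ⊗[k] (H ⊗[k] B)) = 1 ⊗ₜ t := rfl

end Algebras

section Quasitriangular

variable (k : Type u) [Field k] (H : Type u) [Ring H]

/-- A quasitriangular structure on a Hopf algebra: an `R`-matrix `R`. -/
class QuasitriangularHopfAlgebra [HopfAlgebra k H] where
  R : (H ⊗[k] H)ˣ
  comul_left : Algebra.TensorProduct.assoc k k k H H H
      (Algebra.TensorProduct.map (Bialgebra.comulAlgHom k H) (AlgHom.id k H) (R : H ⊗[k] H)) =
    leg13 (R : H ⊗[k] H) * leg23 (R : H ⊗[k] H)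
  comul_right :
    Algebra.TensorProduct.map (AlgHom.id k H) (Bialgebra.comulAlgHom k H) (R : H ⊗[k] H) =
      leg13 (R : H ⊗[k] H) * leg12 (R : H ⊗[k] H)
  comul_op : ∀ h : H, (R : H ⊗[k] H) * Coalgebra.comul h =
    Algebra.TensorProduct.comm k H H (Coalgebra.comul h) * (R : H ⊗[k] H)

/-- A quasitriangular structure on a left comodule algebra over a quasitriangular Hopf algebra:
a `K`-matrix `K`. -/
class QuasitriangularComoduleAlgebra [HopfAlgebra k H] [QuasitriangularHopfAlgebra k H]
    (B : Type u) [Ring B] [Algebra k B] [LeftComoduleAlgebra k H B] where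
  K : (H ⊗[k] B)ˣ
  comul_left : Algebra.TensorProduct.assoc k k k H H B
      (Algebra.TensorProduct.map (Bialgebra.comulAlgHom k H) (AlgHom.id k B) (K : H ⊗[k] B)) =
    leg23 (K : H ⊗[k] B) *
      leg21 (QuasitriangularHopfAlgebra.R (k := k) (H := H) : H ⊗[k] H) *
      leg13 (K : H ⊗[k] B) *
      leg21 (((QuasitriangularHopfAlgebra.R (k := k) (H := H))⁻¹ : (H ⊗[k] H)ˣ) : H ⊗[k] H)
  coact_right :
    Algebra.TensorProduct.map (AlgHom.id k H) (LeftComoduleAlgebra.coact (k := k) (H := H) (B := B))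
        (K : H ⊗[k] B) =
      leg21 (QuasitriangularHopfAlgebra.R (k := k) (H := H) : H ⊗[k] H) *
        leg13 (K : H ⊗[k] B) *
        leg12 (QuasitriangularHopfAlgebra.R (k := k) (H := H) : H ⊗[k] H)
  coact_comm : ∀ b : B, (K : H ⊗[k] B) * LeftComoduleAlgebra.coact b =
    LeftComoduleAlgebra.coact b * (K : H ⊗[k] B)

end Quasitriangular

/-! ### The monoidal category of `H`-modules and its action on `B`-modules -/

namespace FdMod

section Monoidal

variable {k : Type u} [Field k] {H : Type u} [Ring H] [Bialgebra k H]
  {B : Type u} [Ring B] [Algebra k B]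

section Raw

variable {V W U : Type u} [AddCommGroup V] [Module k V] [AddCommGroup W] [Module k W]
  [AddCommGroup U] [Module k U] (ρ : H →ₐ[k] Module.End k V) (σ : H →ₐ[k] Module.End k W)
  (τ : B →ₐ[k] Module.End k U)

lemma outer_right (δ : B →ₐ[k] H ⊗[k] B) (t : H ⊗[k] B) :
    outer ρ ((outer σ τ).comp δ) t =
      outer ρ (outer σ τ) (Algebra.TensorProduct.map (AlgHom.id k H) δ t) := by
  induction t with
  | zero => simp
  | add s t hs ht => simp only [map_add, hs, ht]
  | tmul a b => rfl

lemma outer_left (t : H ⊗[k] B) :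
    (TensorProduct.assoc k V W U).toLinearMap ∘ₗ
        outer ((outer ρ σ).comp (Bialgebra.comulAlgHom k H)) τ t =
      outer ρ (outer σ τ) (Algebra.TensorProduct.assoc k k k H H B
        (Algebra.TensorProduct.map (Bialgebra.comulAlgHom k H) (AlgHom.id k B) t)) ∘ₗ
        (TensorProduct.assoc k V W U).toLinearMap := by
  have key : ∀ (s : H ⊗[k] H) (b : B),
      (TensorProduct.assoc k V W U).toLinearMap ∘ₗ TensorProduct.map (outer ρ σ s) (τ b) =
      outer ρ (outer σ τ) (Algebra.TensorProduct.assoc k k k H H B (s ⊗ₜ b)) ∘ₗ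
        (TensorProduct.assoc k V W U).toLinearMap := by
    intro s b
    induction s with
    | zero => ext; simp
    | add s t hs ht =>
      simp only [map_add, TensorProduct.add_tmul, TensorProduct.map_add_left,
        LinearMap.comp_add, LinearMap.add_comp, hs, ht]
    | tmul a a' => ext; simp
  induction t with
  | zero => ext; simp
  | add s t hs ht => simp only [map_add, LinearMap.comp_add, LinearMap.add_comp, hs, ht]
  | tmul a b => exact key _ _

lemma outer_counit_left (t : H ⊗[k] B) :
    (TensorProduct.lid k U).toLinearMap ∘ₗ
        outer ((Algebra.ofId k (Module.End k k)).comp (Bialgebra.counitAlgHom k H)) τ t =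
      τ (Algebra.TensorProduct.lid k B
        (Algebra.TensorProduct.map (Bialgebra.counitAlgHom k H) (AlgHom.id k B) t)) ∘ₗ
        (TensorProduct.lid k U).toLinearMap := by
  induction t with
  | zero => ext; simp
  | add s t hs ht => simp only [map_add, LinearMap.comp_add, LinearMap.add_comp, hs, ht]
  | tmul a b => ext; simp [Algebra.ofId_apply, Module.algebraMap_end_apply]

lemma outer_counit_right (t : H ⊗[k] H) :
    (TensorProduct.rid k V).toLinearMap ∘ₗ
        outer ρ ((Algebra.ofId k (Module.End k k)).comp (Bialgebra.counitAlgHom k H)) t =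
      ρ (Algebra.TensorProduct.rid k k H
        (Algebra.TensorProduct.map (AlgHom.id k H) (Bialgebra.counitAlgHom k H) t)) ∘ₗ
        (TensorProduct.rid k V).toLinearMap := by
  induction t with
  | zero => ext; simp
  | add s t hs ht => simp only [map_add, LinearMap.comp_add, LinearMap.add_comp, hs, ht]
  | tmul a b => ext; simp [Algebra.ofId_apply, Module.algebraMap_end_apply]

end Raw

/-- The trivial `H`-module `k`, with `H` acting through the counit. -/
noncomputable def unit (k : Type u) [Field k] (H : Type u) [Ring H] [Bialgebra k H] :
    FdMod k H where
  carrier := k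
  ρ := (Algebra.ofId k (Module.End k k)).comp (Bialgebra.counitAlgHom k H)

/-- The associativity isomorphism `(X ⊗ Y) ⊗ Z ≅ X ⊗ (Y ⊗ Z)`. -/
noncomputable def assocIso (δ : B →ₐ[k] H ⊗[k] B)
    (hδ : ∀ b, (Algebra.TensorProduct.assoc k k k H H B)
      (Algebra.TensorProduct.map (Bialgebra.comulAlgHom k H) (AlgHom.id k B) (δ b)) =
      Algebra.TensorProduct.map (AlgHom.id k H) δ (δ b))
    (X Y : FdMod k H) (Z : FdMod k B) :
    tensorAlong δ (tensorAlong (Bialgebra.comulAlgHom k H) X Y) Z ≅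
      tensorAlong δ X (tensorAlong δ Y Z) :=
  mkIso (TensorProduct.assoc k X Y Z) (fun b =>
    (outer_left X.ρ Y.ρ Z.ρ (δ b)).trans (by
      rw [hδ b, ← outer_right X.ρ Y.ρ Z.ρ δ (δ b)]
      rfl))

/-- The unit isomorphism `k ⊗ Z ≅ Z`. -/
noncomputable def lidIso (δ : B →ₐ[k] H ⊗[k] B)
    (hδ : ∀ b, Algebra.TensorProduct.lid k B
      (Algebra.TensorProduct.map (Bialgebra.counitAlgHom k H) (AlgHom.id k B) (δ b)) = b)
    (Z : FdMod k B) : tensorAlong δ (unit k H) Z ≅ Z :=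
  mkIso (TensorProduct.lid k Z) (fun b =>
    (outer_counit_left Z.ρ (δ b)).trans (by rw [hδ b]; rfl))

/-- The unit isomorphism `X ⊗ k ≅ X`. -/
noncomputable def ridIso (X : FdMod k H) :
    tensorAlong (Bialgebra.comulAlgHom k H) X (unit k H) ≅ X :=
  mkIso (TensorProduct.rid k X) (fun h =>
    (outer_counit_right X.ρ (Bialgebra.comulAlgHom k H h)).trans (by
      congr 2
      have := Coalgebra.lTensor_counit_comul (R := k) h
      have h2 : Algebra.TensorProduct.map (AlgHom.id k H) (Bialgebra.counitAlgHom k H)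
        (Bialgebra.comulAlgHom k H h) = h ⊗ₜ[k] (1 : k) := this
      rw [h2]; simp))

lemma comul_coassoc (h : H) : (Algebra.TensorProduct.assoc k k k H H H)
      (Algebra.TensorProduct.map (Bialgebra.comulAlgHom k H) (AlgHom.id k H)
        (Bialgebra.comulAlgHom k H h)) =
      Algebra.TensorProduct.map (AlgHom.id k H) (Bialgebra.comulAlgHom k H)
        (Bialgebra.comulAlgHom k H h) :=
  Coalgebra.coassoc_apply (R := k) h

lemma comul_counit (h : H) : Algebra.TensorProduct.lid k H
      (Algebra.TensorProduct.map (Bialgebra.counitAlgHom k H) (AlgHom.id k H)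
        (Bialgebra.comulAlgHom k H h)) = h := by
  have h2 : Algebra.TensorProduct.map (Bialgebra.counitAlgHom k H) (AlgHom.id k H)
        (Bialgebra.comulAlgHom k H h) = (1 : k) ⊗ₜ[k] h := Coalgebra.rTensor_counit_comul (R := k) h
  rw [h2]; simp

/-- The monoidal category of finite-dimensional `H`-modules:
`h (x ⊗ y) = h₍₁₎ x ⊗ h₍₂₎ y`, with unit `k`. -/
noncomputable instance : MonoidalCategory (FdMod k H) where
  tensorObj X Y := tensorAlong (Bialgebra.comulAlgHom k H) X Y
  tensorHom f g := tensorAlongMap _ f g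
  whiskerLeft X _ _ g := tensorAlongMap _ (𝟙 X) g
  whiskerRight f Y := tensorAlongMap _ f (𝟙 Y)
  tensorUnit := unit k H
  associator X Y Z := assocIso _ comul_coassoc X Y Z
  leftUnitor X := lidIso _ comul_counit X
  rightUnitor X := ridIso X
  tensorHom_def f g := hom_ext (TensorProduct.ext' fun x y => rfl)
  id_tensorHom_id X Y := hom_ext (TensorProduct.ext' fun x y => rfl)
  tensorHom_comp_tensorHom f g f' g' := hom_ext (TensorProduct.ext' fun x y => rfl)
  whiskerLeft_id X Y := hom_ext (TensorProduct.ext' fun x y => rfl)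
  id_whiskerRight X Y := hom_ext (TensorProduct.ext' fun x y => rfl)
  associator_naturality f g h := hom_ext (TensorProduct.ext_threefold fun x y z => rfl)
  leftUnitor_naturality f := hom_ext (TensorProduct.ext' fun c x => (f.hom.map_smul c x).symm)
  rightUnitor_naturality f := hom_ext (TensorProduct.ext' fun x c => (f.hom.map_smul c x).symm)
  pentagon X Y Z W := hom_ext (TensorProduct.ext_fourfold fun x y z w => rfl)
  triangle X Y := hom_ext (TensorProduct.ext_threefold fun x c y =>
    (TensorProduct.smul_tmul (R := k) (show k from c) x y).symm)

/-- The category of finite-dimensional modules over a left `H`-comodule algebra `B` is a left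
module category over `H`-modules: `b (x ⊗ m) = b₍₋₁₎ x ⊗ b₍₀₎ m`. -/
noncomputable instance [LeftComoduleAlgebra k H B] :
    MonoidalLeftAction (FdMod k H) (FdMod k B) where
  actionObj X Y := tensorAlong (LeftComoduleAlgebra.coact (k := k) (H := H) (B := B)) X Y
  actionHom f g := tensorAlongMap _ f g
  actionHomRight X _ _ g := tensorAlongMap _ (𝟙 X) g
  actionHomLeft f Y := tensorAlongMap _ f (𝟙 Y)
  actionAssocIso X Y Z := assocIso _ LeftComoduleAlgebra.coassoc X Y Z
  actionUnitIso X := lidIso _ LeftComoduleAlgebra.counit X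
  actionHom_def f g := hom_ext (TensorProduct.ext' fun x y => rfl)
  actionHomRight_id X Y := hom_ext (TensorProduct.ext' fun x y => rfl)
  id_actionHomLeft X Y := hom_ext (TensorProduct.ext' fun x y => rfl)
  actionHom_comp f f' g g' := hom_ext (TensorProduct.ext' fun x y => rfl)
  actionAssocIso_hom_naturality f g h := hom_ext (TensorProduct.ext_threefold fun x y z => rfl)
  actionUnitIso_hom_naturality f := hom_ext (TensorProduct.ext' fun c x => f.hom.map_smul c x)
  whiskerLeft_actionHomLeft X _ _ f Z := hom_ext (TensorProduct.ext_threefold fun x y z => rfl)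
  whiskerRight_actionHomLeft X f Z := hom_ext (TensorProduct.ext_threefold fun x y z => rfl)
  associator_actionHom X Y Z W := hom_ext (TensorProduct.ext_fourfold fun x y z w => rfl)
  leftUnitor_actionHom X Z := hom_ext (TensorProduct.ext_threefold fun c x z => rfl)
  rightUnitor_actionHom X Z := hom_ext (TensorProduct.ext_threefold fun x c z =>
    TensorProduct.smul_tmul (show k from c) x z)

end Monoidal

end FdMod

/-! ### Duals -/

namespace FdMod

section Dual

variable {k : Type u} [Field k]

lemma coevaluation_slide {V : Type u} [AddCommGroup V] [Module k V] [FiniteDimensional k V]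
    (f : Module.End k V) :
    TensorProduct.map LinearMap.id (Module.Dual.transpose f) (coevaluation k V 1) =
      TensorProduct.map f LinearMap.id (coevaluation k V 1) := by
  classical
  rw [coevaluation_apply_one]
  set b := Module.Basis.ofVectorSpace k V
  simp only [map_sum, TensorProduct.map_tmul, LinearMap.id_apply]
  have h1 : ∀ i, Module.Dual.transpose f (b.coord i) = ∑ j, b.coord i (f (b j)) • b.coord j := by
    intro i
    apply b.ext
    intro l
    simp [Module.Dual.transpose_apply, Finsupp.single_apply]
  have h2 : ∀ j, f (b j) = ∑ i, b.coord i (f (b j)) • b i := by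
    intro j
    simp [b.sum_repr]
  simp only [h1, TensorProduct.tmul_sum]
  rw [Finset.sum_comm]
  refine Finset.sum_congr rfl fun j _ => ?_
  conv_rhs => rw [h2 j, TensorProduct.sum_tmul]
  refine Finset.sum_congr rfl fun i _ => ?_
  rw [TensorProduct.smul_tmul]

variable {H : Type u} [Ring H] [HopfAlgebra k H]

section Raw

variable {V : Type u} [AddCommGroup V] [Module k V] (ρ : H →ₐ[k] Module.End k V)

/-- The action of `H` on the dual space `V^*`: `⟨h f, x⟩ = ⟨f, S(h) x⟩`. -/
noncomputable def dualAction : H →ₐ[k] Module.End k (Module.Dual k V) :=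
  AlgHom.ofLinearMap
    (Module.Dual.transpose ∘ₗ ρ.toLinearMap ∘ₗ HopfAlgebra.antipode k)
    (by ext; simp [Module.Dual.transpose_apply])
    (fun a b => by
      ext; simp [Module.Dual.transpose_apply, HopfAlgebra.antipode_mul_antidistrib])

lemma outer_coevaluation [FiniteDimensional k V] (t : H ⊗[k] H) :
    outer ρ (dualAction ρ) t (coevaluation k V 1) =
      TensorProduct.map (ρ (LinearMap.mul' k H ((HopfAlgebra.antipode k).lTensor H t)))
        LinearMap.id (coevaluation k V 1) := by
  induction t with
  | zero => simp
  | add s t hs ht =>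
    rw [map_add, LinearMap.add_apply, hs, ht, map_add, map_add, map_add, TensorProduct.map_add_left,
      LinearMap.add_apply]
  | tmul a b =>
    have h1 : outer ρ (dualAction ρ) (a ⊗ₜ b) (coevaluation k V 1) =
      TensorProduct.map (ρ a) LinearMap.id (TensorProduct.map LinearMap.id
        (Module.Dual.transpose (ρ (HopfAlgebra.antipode k b))) (coevaluation k V 1)) := by
      rw [← LinearMap.comp_apply (TensorProduct.map _ _), ← TensorProduct.map_comp]; rfl
    rw [h1, coevaluation_slide, ← LinearMap.comp_apply, ← TensorProduct.map_comp]
    simp only [LinearMap.lTensor_tmul, LinearMap.mul'_apply, map_mul]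
    rfl

lemma contractLeft_outer (t : H ⊗[k] H) (f : Module.Dual k V) (x : V) :
    contractLeft k V (outer (dualAction ρ) ρ t (f ⊗ₜ x)) =
      f (ρ (LinearMap.mul' k H ((HopfAlgebra.antipode k).rTensor H t)) x) := by
  induction t with
  | zero => simp
  | add s t hs ht => simp only [map_add, LinearMap.add_apply, hs, ht]
  | tmul a b =>
    simp only [LinearMap.rTensor_tmul, LinearMap.mul'_apply, map_mul]
    rfl

end Raw

/-- The dual `X^*` of a module. -/
noncomputable def dual (X : FdMod k H) : FdMod k H where
  carrier := Module.Dual k X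
  ρ := dualAction X.ρ

/-- `coev : k ⟶ X ⊗ X^*`. -/
noncomputable def coev (X : FdMod k H) : 𝟙_ (FdMod k H) ⟶ X ⊗ X.dual where
  hom := coevaluation k X
  comm h := by
    apply LinearMap.ext_ring
    have h1 := outer_coevaluation X.ρ (Coalgebra.comul h)
    rw [HopfAlgebra.mul_antipode_lTensor_comul_apply] at h1
    refine Eq.trans ?_ h1.symm
    rw [AlgHom.commutes]
    change coevaluation k X (Coalgebra.counit (R := k) h • (1 : k)) = _
    rw [map_smul, Algebra.algebraMap_eq_smul_one, TensorProduct.map_smul_left]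
    change _ = Coalgebra.counit (R := k) h •
      TensorProduct.map LinearMap.id LinearMap.id (coevaluation k X 1)
    rw [TensorProduct.map_id]; rfl

/-- `ev : X^* ⊗ X ⟶ k`. -/
noncomputable def ev (X : FdMod k H) : X.dual ⊗ X ⟶ 𝟙_ (FdMod k H) where
  hom := contractLeft k X
  comm h := TensorProduct.ext' fun f x => by
    let f : Module.Dual k X := f
    have h1 := contractLeft_outer X.ρ (Coalgebra.comul h) f x
    rw [HopfAlgebra.mul_antipode_rTensor_comul_apply, AlgHom.commutes] at h1
    refine h1.trans ?_
    change f (Coalgebra.counit (R := k) h • x) = _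
    rw [map_smul]; rfl

noncomputable instance : RightRigidCategory (FdMod k H) where
  rightDual X :=
    { rightDual := X.dual
      exact :=
        { coevaluation' := coev X
          evaluation' := ev X
          coevaluation_evaluation' := hom_ext (contractLeft_assoc_coevaluation k X)
          evaluation_coevaluation' := hom_ext (contractLeft_assoc_coevaluation' k X) } }

end Dual

end FdMod

/-! ### Braidings -/

namespace FdMod

section Braiding

variable {k : Type u} [Field k] {H : Type u} [Ring H] {B : Type u} [Ring B] [Algebra k B]

section Raw

variable [Algebra k H]
  {V W U : Type u} [AddCommGroup V] [Module k V] [AddCommGroup W] [Module k W]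
  [AddCommGroup U] [Module k U] (ρ : H →ₐ[k] Module.End k V) (σ : H →ₐ[k] Module.End k W)
  (τ : B →ₐ[k] Module.End k U)

lemma comm_outer (t : H ⊗[k] H) :
    (TensorProduct.comm k V W).toLinearMap ∘ₗ outer ρ σ t =
      outer σ ρ (Algebra.TensorProduct.comm k H H t) ∘ₗ
        (TensorProduct.comm k V W).toLinearMap := by
  induction t with
  | zero => ext; simp
  | add s t hs ht => simp only [map_add, LinearMap.comp_add, LinearMap.add_comp, hs, ht]
  | tmul a b => ext; simp

lemma hexagon_forward_aux (ν : H →ₐ[k] Module.End k U) (s t : H ⊗[k] H) :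
    (TensorProduct.assoc k W U V).toLinearMap ∘ₗ (TensorProduct.comm k V (W ⊗[k] U)).toLinearMap ∘ₗ
        outer ρ (outer σ ν) (leg13 s * leg12 t) ∘ₗ (TensorProduct.assoc k V W U).toLinearMap =
      TensorProduct.map LinearMap.id ((TensorProduct.comm k V U).toLinearMap ∘ₗ outer ρ ν s) ∘ₗ
        (TensorProduct.assoc k W V U).toLinearMap ∘ₗ
        TensorProduct.map ((TensorProduct.comm k V W).toLinearMap ∘ₗ outer ρ σ t) LinearMap.id := by
  induction s with
  | zero => simp only [map_zero, mul_zero, zero_mul, LinearMap.comp_zero, LinearMap.zero_comp,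
      TensorProduct.map_zero_left, TensorProduct.map_zero_right]
  | add x y hx hy => simp only [map_add, mul_add, add_mul, LinearMap.comp_add, LinearMap.add_comp,
      TensorProduct.map_add_left, TensorProduct.map_add_right, hx, hy]
  | tmul s₁ s₂ =>
    induction t with
    | zero => simp only [map_zero, mul_zero, zero_mul, LinearMap.comp_zero, LinearMap.zero_comp,
        TensorProduct.map_zero_left, TensorProduct.map_zero_right]
    | add x y hx hy => simp only [map_add, mul_add, add_mul, LinearMap.comp_add, LinearMap.add_comp,
        TensorProduct.map_add_left, TensorProduct.map_add_right, hx, hy]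
    | tmul t₁ t₂ =>
      ext; simp

lemma hexagon_reverse_aux (ν : H →ₐ[k] Module.End k U) (s t : H ⊗[k] H) :
    (TensorProduct.assoc k U V W).symm.toLinearMap ∘ₗ (TensorProduct.comm k (V ⊗[k] W) U).toLinearMap ∘ₗ
        (TensorProduct.assoc k V W U).symm.toLinearMap ∘ₗ outer ρ (outer σ ν) (leg13 s * leg23 t) =
      TensorProduct.map ((TensorProduct.comm k V U).toLinearMap ∘ₗ outer ρ ν s) LinearMap.id ∘ₗ
        (TensorProduct.assoc k V U W).symm.toLinearMap ∘ₗ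
        TensorProduct.map LinearMap.id ((TensorProduct.comm k W U).toLinearMap ∘ₗ outer σ ν t) := by
  induction s with
  | zero => simp only [map_zero, mul_zero, zero_mul, LinearMap.comp_zero, LinearMap.zero_comp,
      TensorProduct.map_zero_left, TensorProduct.map_zero_right]
  | add x y hx hy => simp only [map_add, mul_add, add_mul, LinearMap.comp_add, LinearMap.add_comp,
      TensorProduct.map_add_left, TensorProduct.map_add_right, hx, hy]
  | tmul s₁ s₂ =>
    induction t with
    | zero => simp only [map_zero, mul_zero, zero_mul, LinearMap.comp_zero, LinearMap.zero_comp,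
        TensorProduct.map_zero_left, TensorProduct.map_zero_right]
    | add x y hx hy => simp only [map_add, mul_add, add_mul, LinearMap.comp_add, LinearMap.add_comp,
        TensorProduct.map_add_left, TensorProduct.map_add_right, hx, hy]
    | tmul t₁ t₂ =>
      ext; simp

lemma e_tensor_aux (a b : H ⊗[k] B) (r r' : H ⊗[k] H) :
    outer ρ (outer σ τ) (leg23 a * leg21 r * leg13 b * leg21 r') ∘ₗ
        (TensorProduct.assoc k V W U).toLinearMap =
      TensorProduct.map LinearMap.id (outer σ τ a) ∘ₗ (TensorProduct.assoc k V W U).toLinearMap ∘ₗ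
        TensorProduct.map ((TensorProduct.comm k W V).toLinearMap ∘ₗ outer σ ρ r) LinearMap.id ∘ₗ
        (TensorProduct.assoc k W V U).symm.toLinearMap ∘ₗ
        TensorProduct.map LinearMap.id (outer ρ τ b) ∘ₗ
        (TensorProduct.assoc k W V U).toLinearMap ∘ₗ
        TensorProduct.map (outer σ ρ r' ∘ₗ (TensorProduct.comm k V W).toLinearMap) LinearMap.id := by
  induction a with
  | zero => simp only [map_zero, mul_zero, zero_mul, LinearMap.comp_zero, LinearMap.zero_comp,
      TensorProduct.map_zero_left, TensorProduct.map_zero_right]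
  | add x y hx hy => simp only [map_add, mul_add, add_mul, LinearMap.comp_add, LinearMap.add_comp,
      TensorProduct.map_add_left, TensorProduct.map_add_right, hx, hy]
  | tmul a₁ a₂ =>
    induction r with
    | zero => simp only [map_zero, mul_zero, zero_mul, LinearMap.comp_zero, LinearMap.zero_comp,
        TensorProduct.map_zero_left, TensorProduct.map_zero_right]
    | add x y hx hy => simp only [map_add, mul_add, add_mul, LinearMap.comp_add, LinearMap.add_comp,
        TensorProduct.map_add_left, TensorProduct.map_add_right, hx, hy]
    | tmul r₁ r₂ =>
      induction b with
      | zero => simp only [map_zero, mul_zero, zero_mul, LinearMap.comp_zero, LinearMap.zero_comp,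
          TensorProduct.map_zero_left, TensorProduct.map_zero_right]
      | add x y hx hy => simp only [map_add, mul_add, add_mul, LinearMap.comp_add, LinearMap.add_comp,
          TensorProduct.map_add_left, TensorProduct.map_add_right, hx, hy]
      | tmul b₁ b₂ =>
        induction r' with
        | zero => simp only [map_zero, mul_zero, zero_mul, LinearMap.comp_zero, LinearMap.zero_comp,
            TensorProduct.map_zero_left, TensorProduct.map_zero_right]
        | add x y hx hy => simp only [map_add, mul_add, add_mul, LinearMap.comp_add, LinearMap.add_comp,
            TensorProduct.map_add_left, TensorProduct.map_add_right, hx, hy]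
        | tmul r₃ r₄ =>
          ext; simp

lemma e_action_aux (b : H ⊗[k] B) (r s : H ⊗[k] H) :
    outer ρ (outer σ τ) (leg21 r * leg13 b * leg12 s) ∘ₗ (TensorProduct.assoc k V W U).toLinearMap =
      (TensorProduct.assoc k V W U).toLinearMap ∘ₗ
        TensorProduct.map ((TensorProduct.comm k W V).toLinearMap ∘ₗ outer σ ρ r) LinearMap.id ∘ₗ
        (TensorProduct.assoc k W V U).symm.toLinearMap ∘ₗ
        TensorProduct.map LinearMap.id (outer ρ τ b) ∘ₗ
        (TensorProduct.assoc k W V U).toLinearMap ∘ₗ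
        TensorProduct.map ((TensorProduct.comm k V W).toLinearMap ∘ₗ outer ρ σ s) LinearMap.id := by
  induction r with
  | zero => simp only [map_zero, mul_zero, zero_mul, LinearMap.comp_zero, LinearMap.zero_comp,
      TensorProduct.map_zero_left, TensorProduct.map_zero_right]
  | add x y hx hy => simp only [map_add, mul_add, add_mul, LinearMap.comp_add, LinearMap.add_comp,
      TensorProduct.map_add_left, TensorProduct.map_add_right, hx, hy]
  | tmul r₁ r₂ =>
    induction b with
    | zero => simp only [map_zero, mul_zero, zero_mul, LinearMap.comp_zero, LinearMap.zero_comp,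
        TensorProduct.map_zero_left, TensorProduct.map_zero_right]
    | add x y hx hy => simp only [map_add, mul_add, add_mul, LinearMap.comp_add, LinearMap.add_comp,
        TensorProduct.map_add_left, TensorProduct.map_add_right, hx, hy]
    | tmul b₁ b₂ =>
      induction s with
      | zero => simp only [map_zero, mul_zero, zero_mul, LinearMap.comp_zero, LinearMap.zero_comp,
          TensorProduct.map_zero_left, TensorProduct.map_zero_right]
      | add x y hx hy => simp only [map_add, mul_add, add_mul, LinearMap.comp_add, LinearMap.add_comp,
          TensorProduct.map_add_left, TensorProduct.map_add_right, hx, hy]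
      | tmul s₁ s₂ =>
        ext; simp

/-- The automorphism of `V ⊗ W` given by the action of a unit `u` of `H ⊗ B`. -/
noncomputable def outerEquiv {A₁ B₁ : Type u} [Ring A₁] [Algebra k A₁] [Ring B₁] [Algebra k B₁]
    (ρ : A₁ →ₐ[k] Module.End k V) (σ : B₁ →ₐ[k] Module.End k W) (u : (A₁ ⊗[k] B₁)ˣ) :
    (V ⊗[k] W) ≃ₗ[k] (V ⊗[k] W) :=
  LinearEquiv.ofLinearMap (outer ρ σ (u : A₁ ⊗[k] B₁)) (outer ρ σ ((u⁻¹ : (A₁ ⊗[k] B₁)ˣ) : A₁ ⊗[k] B₁))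
    (by rw [← Module.End.mul_eq_comp, ← map_mul, Units.mul_inv, map_one]; rfl)
    (by rw [← Module.End.mul_eq_comp, ← map_mul, Units.inv_mul, map_one]; rfl)

end Raw

section Hopf

variable [HopfAlgebra k H] [QuasitriangularHopfAlgebra k H]

open QuasitriangularHopfAlgebra (R)

/-- The braiding `x ⊗ y ↦ Rⁱ y ⊗ Rᵢ x`, for `R = Rᵢ ⊗ Rⁱ`. -/
noncomputable def braidingIso (X Y : FdMod k H) : X ⊗ Y ≅ Y ⊗ X :=
  mkIso (outerEquiv X.ρ Y.ρ (R (k := k) (H := H)) ≪≫ₗ TensorProduct.comm k X Y) (fun h => by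
    change (_ ∘ₗ outer X.ρ Y.ρ _) ∘ₗ outer X.ρ Y.ρ (Coalgebra.comul h) =
      outer Y.ρ X.ρ (Coalgebra.comul h) ∘ₗ _ ∘ₗ outer X.ρ Y.ρ _
    rw [LinearMap.comp_assoc, ← Module.End.mul_eq_comp, ← map_mul,
      QuasitriangularHopfAlgebra.comul_op, map_mul, Module.End.mul_eq_comp,
      ← LinearMap.comp_assoc, comm_outer, LinearMap.comp_assoc]
    congr 2
    generalize Coalgebra.comul (R := k) h = t
    induction t with
    | zero => simp
    | add s t hs ht => simp only [map_add, hs, ht]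
    | tmul a b => simp)

noncomputable instance : BraidedCategory (FdMod k H) where
  braiding := braidingIso
  braiding_naturality_right X Y Z f := hom_ext (by
    change (_ ∘ₗ outer X.ρ Z.ρ _) ∘ₗ TensorProduct.map LinearMap.id f.hom =
      TensorProduct.map f.hom LinearMap.id ∘ₗ _ ∘ₗ outer X.ρ Y.ρ _
    rw [LinearMap.comp_assoc]
    erw [← outer_comp_map (𝟙 X) f]
    rw [← LinearMap.comp_assoc, ← LinearMap.comp_assoc]
    congr 1
    exact TensorProduct.ext' fun _ _ => rfl)
  braiding_naturality_left f Z := hom_ext (by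
    change (_ ∘ₗ outer _ Z.ρ _) ∘ₗ TensorProduct.map f.hom LinearMap.id =
      TensorProduct.map LinearMap.id f.hom ∘ₗ _ ∘ₗ outer _ Z.ρ _
    rw [LinearMap.comp_assoc]
    erw [← outer_comp_map f (𝟙 Z)]
    rw [← LinearMap.comp_assoc, ← LinearMap.comp_assoc]
    congr 1
    exact TensorProduct.ext' fun _ _ => rfl)
  hexagon_forward X Y Z := hom_ext (by
    have h := hexagon_forward_aux X.ρ Y.ρ Z.ρ (R (k := k) (H := H) : H ⊗[k] H)
      (R (k := k) (H := H) : H ⊗[k] H)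
    rw [← QuasitriangularHopfAlgebra.comul_right, ← outer_right] at h
    exact h)
  hexagon_reverse X Y Z := hom_ext (by
    have h := hexagon_reverse_aux X.ρ Y.ρ Z.ρ (R (k := k) (H := H) : H ⊗[k] H)
      (R (k := k) (H := H) : H ⊗[k] H)
    rw [← QuasitriangularHopfAlgebra.comul_left] at h
    have h2 : (TensorProduct.assoc k X Y Z).symm.toLinearMap ∘ₗ
        outer X.ρ (outer Y.ρ Z.ρ) (Algebra.TensorProduct.assoc k k k H H H
        (Algebra.TensorProduct.map (Bialgebra.comulAlgHom k H) (AlgHom.id k H)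
          (R (k := k) (H := H) : H ⊗[k] H))) =
        outer ((outer X.ρ Y.ρ).comp (Bialgebra.comulAlgHom k H)) Z.ρ
          (R (k := k) (H := H) : H ⊗[k] H) ∘ₗ (TensorProduct.assoc k X Y Z).symm.toLinearMap := by
      have h3 := outer_left X.ρ Y.ρ Z.ρ (R (k := k) (H := H) : H ⊗[k] H)
      refine (LinearEquiv.toLinearMap_symm_comp_eq _ _).2 ?_
      rw [← LinearMap.comp_assoc, h3, LinearMap.comp_assoc, LinearEquiv.comp_symm,
        LinearMap.comp_id]
    rw [h2] at h
    exact h)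

variable [LeftComoduleAlgebra k H B] [QuasitriangularComoduleAlgebra k H B]

open QuasitriangularComoduleAlgebra (K)
open scoped MonoidalLeftAction

/-- The braiding `x ⊗ m ↦ Kᵢ x ⊗ Kⁱ m`, for `K = Kᵢ ⊗ Kⁱ`. -/
noncomputable def moduleBraidingIso (X : FdMod k H) (M : FdMod k B) : X ⊙ₗ M ≅ X ⊙ₗ M :=
  mkIso (outerEquiv X.ρ M.ρ (K (k := k) (H := H) (B := B))) (fun b => by
    change outer X.ρ M.ρ _ ∘ₗ outer X.ρ M.ρ (LeftComoduleAlgebra.coact b) =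
      outer X.ρ M.ρ (LeftComoduleAlgebra.coact b) ∘ₗ outer X.ρ M.ρ _
    rw [← Module.End.mul_eq_comp, ← Module.End.mul_eq_comp, ← map_mul, ← map_mul,
      QuasitriangularComoduleAlgebra.coact_comm])

noncomputable instance : BraidedLeftModuleCategory (FdMod k H) (FdMod k B) where
  e := moduleBraidingIso
  e_naturality f g := hom_ext (outer_comp_map f g _)
  e_tensor X Y M := hom_ext (by
    have h := e_tensor_aux X.ρ Y.ρ M.ρ (K (k := k) (H := H) (B := B) : H ⊗[k] B)
      (K (k := k) (H := H) (B := B) : H ⊗[k] B) (R (k := k) (H := H) : H ⊗[k] H)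
      (((R (k := k) (H := H))⁻¹ : (H ⊗[k] H)ˣ) : H ⊗[k] H)
    rw [← QuasitriangularComoduleAlgebra.comul_left, ← outer_left] at h
    exact (LinearEquiv.eq_toLinearMap_symm_comp _ _).2 h)
  e_action X Y M := hom_ext (by
    have h := e_action_aux X.ρ Y.ρ M.ρ (K (k := k) (H := H) (B := B) : H ⊗[k] B)
      (R (k := k) (H := H) : H ⊗[k] H) (R (k := k) (H := H) : H ⊗[k] H)
    rw [← QuasitriangularComoduleAlgebra.coact_right, ← outer_right] at h
    exact (LinearEquiv.eq_comp_toLinearMap_symm _ _).2 h)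

end Hopf

end Braiding

end FdMod

/-! ### Factorizable comodule algebras -/

section Factorizable

variable (k : Type u) [Field k] (H : Type u) [Ring H] [HopfAlgebra k H]
  (B : Type u) [Ring B] [Algebra k B] [LeftComoduleAlgebra k H B]

/-- `E(H, B)`: the linear maps `ξ : H → B` such that `ξ(b₍₋₁₎ h) b₍₀₎ = b ξ(h)`
for all `b` and `h`. -/
noncomputable def comoduleEnd : Submodule k (H →ₗ[k] B) where
  carrier := {ξ | ∀ (b : B) (h : H),
    LinearMap.mul' k B (TensorProduct.map (ξ ∘ₗ LinearMap.mulRight k h) LinearMap.id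
      (LeftComoduleAlgebra.coact b : H ⊗[k] B)) = b * ξ h}
  zero_mem' b h := by simp
  add_mem' {ξ η} hξ hη b h := by
    rw [LinearMap.add_comp, TensorProduct.map_add_left, LinearMap.add_apply, map_add, hξ b h,
      hη b h, LinearMap.add_apply, mul_add]
  smul_mem' c ξ hξ b h := by
    rw [LinearMap.smul_comp, TensorProduct.map_smul_left, LinearMap.smul_apply, map_smul, hξ b h,
      LinearMap.smul_apply, mul_smul_comm]

section Aux

variable {k H B}

/-- For `z ∈ H ⊗ B`, the linear map `a ⊗ c ↦ (S(a) ⊗ 1) z (c ⊗ 1)`. -/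
noncomputable def sandwich (z : H ⊗[k] B) : H ⊗[k] H →ₗ[k] H ⊗[k] B :=
  TensorProduct.lift (LinearMap.mk₂ k
    (fun a c => (HopfAlgebra.antipode k a ⊗ₜ[k] (1 : B)) * z * (c ⊗ₜ[k] (1 : B)))
    (fun a a' c => by rw [map_add, TensorProduct.add_tmul, add_mul, add_mul])
    (fun r a c => by
      rw [map_smul, ← TensorProduct.smul_tmul', smul_mul_assoc, smul_mul_assoc])
    (fun a c c' => by rw [TensorProduct.add_tmul, mul_add])
    (fun r a c => by rw [← TensorProduct.smul_tmul', mul_smul_comm]))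

lemma sandwich_tmul (z : H ⊗[k] B) (a c : H) :
    sandwich z (a ⊗ₜ c) = (HopfAlgebra.antipode k a ⊗ₜ[k] (1 : B)) * z * (c ⊗ₜ[k] (1 : B)) := rfl

lemma sandwich_zero (s : H ⊗[k] H) : sandwich (0 : H ⊗[k] B) s = 0 := by
  induction s with
  | zero => exact map_zero _
  | add s t hs ht => rw [map_add, hs, ht, add_zero]
  | tmul a c => rw [sandwich_tmul, mul_zero, zero_mul]

lemma sandwich_add (z w : H ⊗[k] B) (s : H ⊗[k] H) :
    sandwich (z + w) s = sandwich z s + sandwich w s := by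
  induction s with
  | zero => simp only [map_zero, add_zero]
  | add s t hs ht => rw [map_add, hs, ht, map_add, map_add, add_add_add_comm]
  | tmul a c => simp only [sandwich_tmul, mul_add, add_mul]

lemma sandwich_mul (z : H ⊗[k] B) (t s : H ⊗[k] H) :
    sandwich z (t * s) = sandwich (sandwich z t) s := by
  induction s with
  | zero => simp only [mul_zero, map_zero]
  | add s s' hs hs' => rw [mul_add, map_add, map_add, hs, hs']
  | tmul p q =>
    induction t with
    | zero => simp only [zero_mul, map_zero, sandwich_zero]
    | add t t' ht ht' => rw [add_mul, map_add, map_add, sandwich_add, ht, ht']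
    | tmul a c =>
      have h1 : (HopfAlgebra.antipode k p * HopfAlgebra.antipode k a) ⊗ₜ[k] (1 : B) =
          (HopfAlgebra.antipode k p ⊗ₜ[k] 1) * (HopfAlgebra.antipode k a ⊗ₜ[k] 1) := by simp
      have h2 : (c * q) ⊗ₜ[k] (1 : B) = (c ⊗ₜ[k] 1) * (q ⊗ₜ[k] 1) := by simp
      rw [Algebra.TensorProduct.tmul_mul_tmul, sandwich_tmul, sandwich_tmul, sandwich_tmul,
        HopfAlgebra.antipode_mul_antidistrib, h1, h2]
      simp only [mul_assoc]

lemma sandwich_mul_right (z : H ⊗[k] B) (b : B) (s : H ⊗[k] H) :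
    sandwich z s * (1 ⊗ₜ b) = sandwich (z * (1 ⊗ₜ b)) s := by
  induction s with
  | zero => simp only [map_zero, zero_mul]
  | add s t hs ht => rw [map_add, add_mul, hs, ht, map_add]
  | tmul a c =>
    have h1 : (c ⊗ₜ[k] (1 : B)) * (1 ⊗ₜ b) = (1 ⊗ₜ b) * (c ⊗ₜ[k] (1 : B)) := by simp
    rw [sandwich_tmul, sandwich_tmul, mul_assoc, h1]
    simp only [mul_assoc]

lemma sandwich_mul_left (z : H ⊗[k] B) (b : B) (s : H ⊗[k] H) :
    sandwich ((1 ⊗ₜ b) * z) s = (1 ⊗ₜ b) * sandwich z s := by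
  induction s with
  | zero => simp only [map_zero, mul_zero]
  | add s t hs ht => rw [map_add, map_add, mul_add, hs, ht]
  | tmul a c =>
    have h1 : (HopfAlgebra.antipode k a ⊗ₜ[k] (1 : B)) * (1 ⊗ₜ b) =
      (1 ⊗ₜ b) * (HopfAlgebra.antipode k a ⊗ₜ[k] (1 : B)) := by simp
    rw [sandwich_tmul, sandwich_tmul, ← mul_assoc, h1]
    simp only [mul_assoc]

/-- For `z ∈ H ⊗ B`, the linear map `a ⊗ w ↦ (S(a) ⊗ 1) z w`. -/
noncomputable def antipodeMul (z : H ⊗[k] B) : H ⊗[k] (H ⊗[k] B) →ₗ[k] H ⊗[k] B :=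
  TensorProduct.lift (LinearMap.mk₂ k
    (fun a w => (HopfAlgebra.antipode k a ⊗ₜ[k] (1 : B)) * z * w)
    (fun a a' c => by rw [map_add, TensorProduct.add_tmul, add_mul, add_mul])
    (fun r a c => by
      rw [map_smul, ← TensorProduct.smul_tmul', smul_mul_assoc, smul_mul_assoc])
    (fun a c c' => by rw [mul_add])
    (fun r a c => by rw [mul_smul_comm]))

lemma antipodeMul_tmul (z : H ⊗[k] B) (a : H) (w : H ⊗[k] B) :
    antipodeMul z (a ⊗ₜ w) = (HopfAlgebra.antipode k a ⊗ₜ[k] (1 : B)) * z * w := rfl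

lemma antipodeMul_assoc (z : H ⊗[k] B) (t : H ⊗[k] H) (b : B) :
    antipodeMul z (Algebra.TensorProduct.assoc k k k H H B (t ⊗ₜ b)) =
      sandwich z t * (1 ⊗ₜ b) := by
  induction t with
  | zero => simp only [TensorProduct.zero_tmul, map_zero, zero_mul]
  | add s t hs ht => rw [TensorProduct.add_tmul, map_add, map_add, map_add, add_mul, hs, ht]
  | tmul a c =>
    have h1 : (c ⊗ₜ[k] (1 : B)) * (1 ⊗ₜ b) = c ⊗ₜ b := by simp
    rw [Algebra.TensorProduct.assoc_tmul, antipodeMul_tmul, sandwich_tmul,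
      mul_assoc _ (c ⊗ₜ[k] (1 : B)), h1]

lemma sandwich_one (t : H ⊗[k] H) : sandwich (1 : H ⊗[k] B) t =
    LinearMap.mul' k H ((HopfAlgebra.antipode k).rTensor H t) ⊗ₜ 1 := by
  induction t with
  | zero => simp
  | add s t hs ht => rw [map_add, hs, ht, map_add, map_add, TensorProduct.add_tmul]
  | tmul a c => simp [sandwich_tmul]

lemma antipodeMul_one_coact (b : B) :
    antipodeMul 1 (Algebra.TensorProduct.map (AlgHom.id k H)
      (LeftComoduleAlgebra.coact (H := H)) (LeftComoduleAlgebra.coact b)) =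
        (1 : H) ⊗ₜ[k] b := by
  rw [← LeftComoduleAlgebra.coassoc]
  have h2 : ∀ t : H ⊗[k] B, antipodeMul 1 (Algebra.TensorProduct.assoc k k k H H B
      (Algebra.TensorProduct.map (Bialgebra.comulAlgHom k H) (AlgHom.id k B) t)) =
      1 ⊗ₜ Algebra.TensorProduct.lid k B
        (Algebra.TensorProduct.map (Bialgebra.counitAlgHom k H) (AlgHom.id k B) t) := by
    intro t
    induction t with
    | zero => simp
    | add s t hs ht => simp only [TensorProduct.tmul_add, map_add, hs, ht]
    | tmul a b =>
      rw [Algebra.TensorProduct.map_tmul, antipodeMul_assoc, sandwich_one]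
      simp [Algebra.algebraMap_eq_smul_one, TensorProduct.smul_tmul]
  rw [h2, LeftComoduleAlgebra.counit]

lemma antipodeMul_coact (z : H ⊗[k] B)
    (hz : ∀ b : B, z * LeftComoduleAlgebra.coact b = LeftComoduleAlgebra.coact b * z) (b : B) :
    antipodeMul z (Algebra.TensorProduct.map (AlgHom.id k H)
      (LeftComoduleAlgebra.coact (H := H)) (LeftComoduleAlgebra.coact b)) =
        ((1 : H) ⊗ₜ[k] b) * z := by
  rw [← antipodeMul_one_coact]
  generalize (LeftComoduleAlgebra.coact b : H ⊗[k] B) = t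
  induction t with
  | zero => simp
  | add s t hs ht => simp only [add_mul, map_add, hs, ht]
  | tmul a b =>
    rw [Algebra.TensorProduct.map_tmul, antipodeMul_tmul, antipodeMul_tmul, mul_assoc, hz, mul_one,
      mul_assoc]

lemma sandwich_coact (z : H ⊗[k] B)
    (hz : ∀ b : B, z * LeftComoduleAlgebra.coact b = LeftComoduleAlgebra.coact b * z)
    (b : B) (h : H) :
    LinearMap.mul' k (H ⊗[k] B) (TensorProduct.map
      ((sandwich z ∘ₗ Coalgebra.comul) ∘ₗ LinearMap.mulRight k h)
      (Algebra.TensorProduct.includeRight (R := k) (A := H) (B := B)).toLinearMap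
        (LeftComoduleAlgebra.coact b : H ⊗[k] B)) =
      (1 ⊗ₜ b) * sandwich z (Coalgebra.comul h) := by
  rw [← sandwich_mul_left, ← antipodeMul_coact z hz b, ← LeftComoduleAlgebra.coassoc]
  generalize (LeftComoduleAlgebra.coact b : H ⊗[k] B) = t
  induction t with
  | zero => simp only [map_zero, sandwich_zero]
  | add s t hs ht => simp only [map_add, sandwich_add, hs, ht]
  | tmul x b' =>
    rw [Algebra.TensorProduct.map_tmul, antipodeMul_assoc, ← sandwich_mul_right,
      Bialgebra.comulAlgHom_apply, ← sandwich_mul, ← Bialgebra.comul_mul]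
    rfl

end Aux

variable [QuasitriangularHopfAlgebra k H] [QuasitriangularComoduleAlgebra k H B]

open QuasitriangularComoduleAlgebra (K)

/-- The linear map `h ↦ S(h₍₁₎) Kᵢ h₍₂₎ ⊗ Kⁱ`. -/
noncomputable def conjK : H →ₗ[k] H ⊗[k] B :=
  sandwich (K (k := k) (H := H) (B := B) : H ⊗[k] B) ∘ₗ Coalgebra.comul

/-- The map `f ↦ [h ↦ ⟨f, S(h₍₁₎) Kᵢ h₍₂₎⟩ Kⁱ]`, with values in all linear maps `H → B`. -/
noncomputable def thetaAux : Module.Dual k H →ₗ[k] (H →ₗ[k] B) where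
  toFun f := (TensorProduct.lid k B).toLinearMap ∘ₗ TensorProduct.map f LinearMap.id ∘ₗ conjK k H B
  map_add' f g := by
    rw [TensorProduct.map_add_left, LinearMap.add_comp, LinearMap.comp_add]
  map_smul' c f := by
    rw [TensorProduct.map_smul_left, LinearMap.smul_comp, LinearMap.comp_smul, RingHom.id_apply]

variable {k H B}

lemma conjK_coact (b : B) (h : H) :
    LinearMap.mul' k (H ⊗[k] B) (TensorProduct.map (conjK k H B ∘ₗ LinearMap.mulRight k h)
      (Algebra.TensorProduct.includeRight (R := k) (A := H) (B := B)).toLinearMap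
        (LeftComoduleAlgebra.coact b : H ⊗[k] B)) = (1 ⊗ₜ b) * conjK k H B h :=
  sandwich_coact _ QuasitriangularComoduleAlgebra.coact_comm b h

lemma thetaAux_mem (f : Module.Dual k H) : thetaAux k H B f ∈ comoduleEnd k H B := by
  intro b h
  let g : H ⊗[k] B →ₗ[k] B := (TensorProduct.lid k B).toLinearMap ∘ₗ TensorProduct.map f LinearMap.id
  have hg : ∀ (b : B) (z : H ⊗[k] B), b * g z = g ((1 ⊗ₜ b) * z) := by
    intro b z
    induction z with
    | zero => simp
    | add z w hz hw => simp only [mul_add, map_add, hz, hw]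
    | tmul a c => simp [g]
  have hg' : ∀ (b : B) (z : H ⊗[k] B), g z * b = g (z * (1 ⊗ₜ b)) := by
    intro b z
    induction z with
    | zero => simp
    | add z w hz hw => simp only [add_mul, map_add, hz, hw]
    | tmul a c => simp [g]
  have h1 : ∀ h, thetaAux k H B f h = g (conjK k H B h) := fun h => rfl
  rw [h1, hg, ← conjK_coact]
  generalize (LeftComoduleAlgebra.coact b : H ⊗[k] B) = t
  induction t with
  | zero => simp
  | add s t hs ht => simp only [map_add, hs, ht]
  | tmul x c => exact hg' c _

variable (k H B)

/-- `θ_B : H^* → E(H, B)`, `f ↦ [h ↦ ⟨f, S(h₍₁₎) Kᵢ h₍₂₎⟩ Kⁱ]`. -/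
noncomputable def theta : Module.Dual k H →ₗ[k] comoduleEnd k H B :=
  (thetaAux k H B).codRestrict (comoduleEnd k H B) thetaAux_mem

/-- A quasitriangular left `H`-comodule algebra is factorizable if `θ_B` is bijective. -/
def IsFactorizableComoduleAlgebra : Prop := Function.Bijective (theta k H B)

end Factorizable

/-! Both ends can be computed explicitly, and in these models the universal copairing is the
solution of one equation in `H ⊗ E(H, B)`.

A wedge over `X ⊗ X^*` is a family of natural endomorphisms of the underlying vector spaces of
modules. Such an endomorphism is the action of an element of `H`, found by applying it to `1` in the
regular module, so `E_C` is `H` with the adjoint action (`adjointWedgeIsLimit`). With `Hom(M, N) =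
Hom_B(H ⊗ M, N)`, the same argument on the regular `B`-module shows that `E_M` is `E(H, B)`, an
element `ξ` giving the maps `h ⊗ m ↦ ξ(h) m` (`comoduleEndWedgeIsLimit`).

A copairing is then an element `s = ∑ a ⊗ ξ` of `H ⊗ E(H, B)`. Evaluating its defining property at
`x`, `h`, `m` gives `∑ a S(h₍₁₎) x ⊗ ξ(h₍₂₎) m` on one side (`evalAt_end`) and `S(Kᵢ h) x ⊗ Kⁱ m` on
the other (`evalAt_copairingTarget`). On regular modules, with `x = m = 1`, this becomes `∑ a
S(h₍₁₎) ⊗ ξ(h₍₂₎) = S(Kᵢ h) ⊗ Kⁱ`. Cancelling `S(h₍₁₎)` by convolution yields `∑ a ⊗ ξ(h) =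
S(S(h₍₁₎) Kᵢ h₍₂₎) ⊗ Kⁱ` (`convEnd_eq_K_iff`). Contracting the first leg with `f` shows that `θ_M(f)
= θ_B(f ∘ S)` (`theta_comp_antipode`).

The antipode is bijective because the category is braided (`antipode_bijective`), so `θ_M` is
bijective exactly when `θ_B` is. Since nondegeneracy is stated for some choice of internal Homs and
ends, it must also be shown independent of that choice (`isNondegenerateModuleCategory_iff`). -/

/-! ### Independence of the choice of internal Homs and ends -/

namespace CategoryTheory

open MonoidalLeftAction Limits Opposite

section General

variable {C : Type u₁} [Category.{v₁} C] [MonoidalCategory C]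
  {M : Type u₂} [Category.{v₂} M]

/-- The projection of a wedge over `F` to `F(j, j)`. -/
def Limits.Wedge.proj {F : Mᵒᵖ ⥤ M ⥤ C} (W : Wedge F) (j : M) : W.pt ⟶ (F.obj (op j)).obj j :=
  W.ι j

lemma Limits.Wedge.proj_condition {F : Mᵒᵖ ⥤ M ⥤ C} (W : Wedge F) {i j : M} (f : i ⟶ j) :
    W.proj i ≫ (F.obj (op i)).map f = W.proj j ≫ (F.map f.op).app j :=
  W.condition f

lemma Limits.Wedge.IsLimit.hom_ext_proj {F : Mᵒᵖ ⥤ M ⥤ C} {W : Wedge F} (hW : IsLimit W)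
    {X : C} {f g : X ⟶ W.pt} (h : ∀ j, f ≫ W.proj j = g ≫ W.proj j) : f = g :=
  Wedge.IsLimit.hom_ext hW h

namespace InternalHoms

variable [MonoidalLeftAction C M] (I I' : InternalHoms C M)

lemma zeta_naturality_left {X Y : C} (f : X ⟶ Y) {m n : M} (g : Y ⊙ₗ m ⟶ n) :
    I.zeta X m n (f ⊵ₗ m ≫ g) = f ≫ I.zeta Y m n g :=
  I.adj.homEquiv_naturality_two f g

lemma zeta_naturality_right {X : C} {m n n' : M} (f : X ⊙ₗ m ⟶ n) (g : n ⟶ n') :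
    I.zeta X m n' (f ≫ g) = I.zeta X m n f ≫ (I.hom.obj (op m)).map g :=
  I.adj.homEquiv_naturality_three g f

lemma zeta_naturality_middle {X : C} {m m' n : M} (f : m ⟶ m') (g : X ⊙ₗ m' ⟶ n) :
    I.zeta X m n (X ⊴ₗ f ≫ g) = I.zeta X m' n g ≫ (I.hom.map f.op).app n :=
  I.adj.homEquiv_naturality_one f g

lemma zeta_ev (m n : M) : I.zeta _ m n (I.ev m n) = 𝟙 _ :=
  (I.zeta _ m n).apply_symm_apply _

lemma zeta_symm_whisker_ev {X : C} {m n : M} (f : X ⊙ₗ m ⟶ n) :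
    I.zeta X m n f ⊵ₗ m ≫ I.ev m n = f := by
  apply (I.zeta X m n).injective
  rw [zeta_naturality_left, zeta_ev, Category.comp_id]

/-- The canonical morphism between two choices of the internal Hom of `m` and `n`. -/
def compare (m n : M) : I.obj m n ⟶ I'.obj m n := I'.zeta _ m n (I.ev m n)

/-- Every `f` factors through `ev`, so naturality in `X` reduces the claim to the definition of
`compare`. All later compatibilities of `compare` come from this lemma and `compare_ev`. -/
lemma zeta_compare {X : C} {m n : M} (f : X ⊙ₗ m ⟶ n) :
    I.zeta X m n f ≫ I.compare I' m n = I'.zeta X m n f := by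
  rw [compare, ← zeta_naturality_left, zeta_symm_whisker_ev]

lemma compare_ev (m n : M) : I.compare I' m n ⊵ₗ m ≫ I'.ev m n = I.ev m n :=
  zeta_symm_whisker_ev _ _

lemma ev_naturality_right (m : M) {n n' : M} (g : n ⟶ n') :
    (I.hom.obj (op m)).map g ⊵ₗ m ≫ I.ev m n' = I.ev m n ≫ g := by
  apply (I.zeta _ m n').injective
  rw [zeta_naturality_left, zeta_ev, zeta_naturality_right, zeta_ev, Category.comp_id,
    Category.id_comp]

lemma ev_naturality_left {m m' : M} (f : m ⟶ m') (n : M) :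
    (I.hom.map f.op).app n ⊵ₗ m ≫ I.ev m n = _ ⊴ₗ f ≫ I.ev m' n := by
  apply (I.zeta _ m n).injective
  rw [zeta_naturality_left, zeta_ev, zeta_naturality_middle, zeta_ev, Category.comp_id,
    Category.id_comp]

lemma compare_naturality_right (m : M) {n n' : M} (g : n ⟶ n') :
    (I.hom.obj (op m)).map g ≫ I.compare I' m n' =
      I.compare I' m n ≫ (I'.hom.obj (op m)).map g := by
  rw [compare, compare, ← zeta_naturality_left, ← zeta_naturality_right, ev_naturality_right]

lemma compare_naturality_left {m m' : M} (f : m ⟶ m') (n : M) :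
    (I.hom.map f.op).app n ≫ I.compare I' m n =
      I.compare I' m' n ≫ (I'.hom.map f.op).app n := by
  rw [compare, compare, ← zeta_naturality_left, ← zeta_naturality_middle, ev_naturality_left]

lemma compare_comp_compare (m n : M) : I.compare I' m n ≫ I'.compare I m n = 𝟙 _ := by
  rw [compare, zeta_compare, zeta_ev]

lemma coev_compare (m : M) : I.coev m ≫ I.compare I' m m = I'.coev m :=
  zeta_compare _ _ _

lemma tensorComparison_compare (X : C) (m n : M) :
    I.tensorComparison X m n ≫ I.compare I' m (X ⊙ₗ n) =
      X ◁ I.compare I' m n ≫ I'.tensorComparison X m n := by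
  rw [tensorComparison, zeta_compare, tensorComparison, ← zeta_naturality_left]
  congr 1
  rw [← compare_ev I I' m n, actionHomRight_comp, whiskerLeft_actionHomLeft]
  simp

end InternalHoms

/-- The first factor enters contravariantly: dinaturality of the evaluation moves `a` across it and
turns it into its mate. -/
lemma copairingMap_comp [RightRigidCategory C] {E E' F F' : C} (ω : 𝟙_ C ⟶ E ⊗ E')
    (a : E ⟶ F) (b : E' ⟶ F') :
    copairingMap (ω ≫ (a ⊗ₘ b)) = aᘁ ≫ copairingMap ω ≫ b := by
  have h : _ ◁ a ≫ ε_ F _ = aᘁ ▷ E ≫ ε_ E _ := (rightAdjointMate_comp_evaluation a).symm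
  have h1 : aᘁ ≫ copairingMap ω ≫ b =
      (ρ_ _).inv ≫ _ ◁ ω ≫ (α_ _ _ _).inv ≫ (aᘁ ▷ E ≫ ε_ E _) ▷ E' ≫ (λ_ _).hom ≫ b := by
    simp only [copairingMap, Category.assoc, comp_whiskerRight]
    rw [← associator_inv_naturality_left_assoc, whisker_exchange_assoc,
      ← rightUnitor_inv_naturality_assoc]
  rw [h1, ← h, copairingMap, MonoidalCategory.tensorHom_def]
  simp only [MonoidalCategory.whiskerLeft_comp, Category.assoc, comp_whiskerRight]
  rw [associator_inv_naturality_right_assoc, whisker_exchange_assoc, leftUnitor_naturality,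
    associator_inv_naturality_middle_assoc]

variable [RightRigidCategory C] [BraidedCategory C] [MonoidalLeftAction C M]
  [BraidedLeftModuleCategory C M]

/-- Each ingredient of the defining equation (coevaluation, tensor comparison, the braiding inside
`Hom`) commutes with `compare`, so postcomposition with `X ◁ compare` carries the equation for `I`
to that for `I'`. The projections are arbitrary morphisms here, which keeps the wedges out of the
computation. -/
lemma InternalHoms.copairing_compare (I I' : InternalHoms C M) {X : C} {m : M} {E E' F F' : C}
    {ω : 𝟙_ C ⟶ E ⊗ E'} {a : E ⟶ F} {b : E' ⟶ F'} {p : E ⟶ X ⊗ Xᘁ} {p' : F ⟶ X ⊗ Xᘁ}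
    {q : E' ⟶ I.obj m m} {q' : F' ⟶ I'.obj m m} (ha : a ≫ p' = p)
    (hb : b ≫ q' = q ≫ I.compare I' m m)
    (h : ω ≫ (p ⊗ₘ q) ≫ (α_ X Xᘁ (I.obj m m)).hom ≫ X ◁ I.tensorComparison Xᘁ m m =
      (λ_ (𝟙_ C)).inv ≫ (η_ X Xᘁ ⊗ₘ I.coev m) ≫ (α_ X Xᘁ (I.obj m m)).hom ≫
        X ◁ I.tensorComparison Xᘁ m m ≫
          X ◁ (I.hom.obj (op m)).map (BraidedLeftModuleCategory.e Xᘁ m).hom) :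
    (ω ≫ (a ⊗ₘ b)) ≫ (p' ⊗ₘ q') ≫ (α_ X Xᘁ (I'.obj m m)).hom ≫ X ◁ I'.tensorComparison Xᘁ m m =
      (λ_ (𝟙_ C)).inv ≫ (η_ X Xᘁ ⊗ₘ I'.coev m) ≫ (α_ X Xᘁ (I'.obj m m)).hom ≫
        X ◁ I'.tensorComparison Xᘁ m m ≫
          X ◁ (I'.hom.obj (op m)).map (BraidedLeftModuleCategory.e Xᘁ m).hom := by
  have h2 : ((X ⊗ Xᘁ) ◁ I.compare I' m m) ≫ (α_ X Xᘁ (I'.obj m m)).hom ≫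
        X ◁ I'.tensorComparison Xᘁ m m =
      ((α_ X Xᘁ (I.obj m m)).hom ≫ X ◁ I.tensorComparison Xᘁ m m) ≫
        X ◁ I.compare I' m (Xᘁ ⊙ₗ m) := by
    simp only [Category.assoc, ← MonoidalCategory.whiskerLeft_comp,
      InternalHoms.tensorComparison_compare]
    simp
  have h3 : (a ⊗ₘ b) ≫ (p' ⊗ₘ q') = (p ⊗ₘ q) ≫ ((X ⊗ Xᘁ) ◁ I.compare I' m m) := by
    rw [tensorHom_comp_tensorHom, ha, hb, ← id_tensorHom, tensorHom_comp_tensorHom,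
      Category.comp_id]
  have h4 : (η_ X Xᘁ ⊗ₘ I'.coev m) =
      (η_ X Xᘁ ⊗ₘ I.coev m) ≫ ((X ⊗ Xᘁ) ◁ I.compare I' m m) := by
    rw [← id_tensorHom, tensorHom_comp_tensorHom, InternalHoms.coev_compare, Category.comp_id]
  simp only [Category.assoc] at h h2 ⊢
  rw [reassoc_of% h3, h4, h2, reassoc_of% h, Category.assoc, reassoc_of% h2]
  simp only [← MonoidalCategory.whiskerLeft_comp, InternalHoms.compare_naturality_right]

lemma IsUniversalCopairing.compare {I : InternalHoms C M} {EC : Wedge (tensorDual C)}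
    {EM : Wedge I.hom} {ω : 𝟙_ C ⟶ EC.pt ⊗ EM.pt} (h : IsUniversalCopairing I EC EM ω)
    (I' : InternalHoms C M) {EC' : Wedge (tensorDual C)} {EM' : Wedge I'.hom}
    (a : EC.pt ⟶ EC'.pt) (b : EM.pt ⟶ EM'.pt) (ha : ∀ X, a ≫ EC'.proj X = EC.proj X)
    (hb : ∀ m, b ≫ EM'.proj m = EM.proj m ≫ I.compare I' m m) :
    IsUniversalCopairing I' EC' EM' (ω ≫ (a ⊗ₘ b)) := fun X m =>
  I.copairing_compare I' (ha X) (hb m) (h X m)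

/-- Nondegeneracy can be tested on any choice of the internal Homs and of the two ends. -/
lemma isNondegenerateModuleCategory_iff (I : InternalHoms C M) (EC : Wedge (tensorDual C))
    (EM : Wedge I.hom) (hC : IsLimit EC) (hM : IsLimit EM) :
    IsNondegenerateModuleCategory C M ↔ ∃ ω : 𝟙_ C ⟶ EC.pt ⊗ EM.pt,
      IsUniversalCopairing I EC EM ω ∧ IsIso (copairingMap ω) := by
  refine ⟨?_, fun ⟨ω, h⟩ => ⟨I, EC, EM, hC, hM, ω, h⟩⟩
  rintro ⟨J, FC, FM, hFC, hFM, ω, hω, hiso⟩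
  -- Composing with `compare` turns a wedge over one bifunctor into a wedge over the other. Applied
  -- in both directions, this gives the mutually inverse `b` and `b'`.
  have key : ∀ (I I' : InternalHoms C M) (F : Wedge I.hom) (F' : Wedge I'.hom)
      (hF' : IsLimit F'), ∃ b : F.pt ⟶ F'.pt, ∀ m, b ≫ F'.proj m = F.proj m ≫ I.compare I' m m := by
    intro I I' F F' hF'
    refine ⟨Wedge.IsLimit.lift hF' (fun m => F.proj m ≫ I.compare I' m m) ?_,
      fun m => Wedge.IsLimit.lift_ι hF' _ _ m⟩
    intro i j g
    rw [Category.assoc, ← InternalHoms.compare_naturality_right, Category.assoc,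
      ← InternalHoms.compare_naturality_left, ← Category.assoc, ← Category.assoc,
      Wedge.proj_condition]
  let a : FC.pt ≅ EC.pt := IsLimit.conePointUniqueUpToIso hFC hC
  have ha : ∀ X, a.hom ≫ EC.proj X = FC.proj X := fun X =>
    IsLimit.conePointUniqueUpToIso_hom_comp hFC hC _
  obtain ⟨b, hb⟩ := key J I FM EM hM
  obtain ⟨b', hb'⟩ := key I J EM FM hFM
  have hbb : IsIso b := ⟨b', Wedge.IsLimit.hom_ext_proj hFM fun m => by
      rw [Category.assoc, hb', ← Category.assoc, hb, Category.assoc,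
        InternalHoms.compare_comp_compare, Category.comp_id, Category.id_comp],
    Wedge.IsLimit.hom_ext_proj hM fun m => by
      rw [Category.assoc, hb, ← Category.assoc, hb', Category.assoc,
        InternalHoms.compare_comp_compare, Category.comp_id, Category.id_comp]⟩
  have haa : IsIso (a.homᘁ) := ⟨a.invᘁ, by
    rw [← comp_rightAdjointMate, a.inv_hom_id, rightAdjointMate_id], by
    rw [← comp_rightAdjointMate, a.hom_inv_id, rightAdjointMate_id]⟩
  refine ⟨ω ≫ (a.hom ⊗ₘ b), hω.compare I a.hom b ha hb, ?_⟩
  rw [copairingMap_comp]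
  infer_instance

end General

end CategoryTheory

/-! ### Regular modules and the antipode -/

namespace FdMod

section Regular

variable {k : Type u} [Field k] {A : Type u} [Ring A] [Algebra k A] [FiniteDimensional k A]

variable (k A) in
/-- The left regular module. -/
noncomputable def reg : FdMod k A where
  carrier := A
  ρ := Algebra.lmul k A

/-- The morphism `a ↦ a x` from the left regular module. -/
noncomputable def orbit (X : FdMod k A) (x : X) : reg k A ⟶ X where
  hom := LinearMap.applyₗ x ∘ₗ X.ρ.toLinearMap
  comm a := LinearMap.ext fun (b : A) => by
    change X.ρ (a * b) x = X.ρ a (X.ρ b x)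
    rw [map_mul]; rfl

lemma orbit_hom_apply (X : FdMod k A) (x : X) (a : A) : (orbit X x).hom a = X.ρ a x := rfl

end Regular

section Antipode

variable {k : Type u} [Field k] {H : Type u} [Ring H] [HopfAlgebra k H] [FiniteDimensional k H]
  [QuasitriangularHopfAlgebra k H]

variable (k H) in
/-- The antipode of a finite-dimensional quasitriangular Hopf algebra is bijective: in a braided
category with right duals, every object is isomorphic to its double dual. -/
lemma antipode_bijective : Function.Bijective (HopfAlgebra.antipode k (A := H)) := by
  have hinj : Function.Injective (HopfAlgebra.antipode k (A := H)) := by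
    rw [injective_iff_map_eq_zero]
    intro h hh
    let X := reg k H
    let Y : FdMod k H := X.dual
    have : ExactPairing X Y := HasRightDual.exact (X := X)
    -- The braiding reverses the pairing of `X` with `Y = X^*`, so `X` is itself a right dual of
    -- `Y`; uniqueness of duals gives `X^** ≅ X`.
    let i : Y.dual ≅ X := rightDualIso (X := Y) (HasRightDual.exact (X := Y))
      (BraidedCategory.exactPairing_swap X Y)
    -- On the double dual, `h` acts through `S²(h)`, which vanishes. The isomorphism then makes `h`
    -- act by zero on the faithful regular module.
    have h0 : Y.dual.ρ h = 0 := by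
      refine LinearMap.ext fun (φ : Module.Dual k (Module.Dual k H)) => ?_
      refine LinearMap.ext fun (f : Module.Dual k H) => ?_
      change φ (f ∘ₗ LinearMap.mulLeft k
        (HopfAlgebra.antipode k (HopfAlgebra.antipode k h))) = 0
      rw [hh, map_zero]
      simp
    have h1 : X.ρ h (1 : H) = 0 := by
      have h2 : i.hom.hom (i.inv.hom (1 : H)) = (1 : H) :=
        LinearMap.congr_fun (congrArg Hom.hom i.inv_hom_id) (1 : H)
      have h3 := comm_apply i.hom h (i.inv.hom (1 : H))
      rw [h2, h0] at h3
      rw [← h3]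
      simp
    simpa using (show h * 1 = 0 from h1)
  exact ⟨hinj, LinearMap.surjective_of_injective hinj⟩

end Antipode

/-! ### Internal Homs -/

section InternalHom

open MonoidalLeftAction Opposite

variable {k : Type u} [Field k] {H : Type u} [Ring H] [Bialgebra k H] [FiniteDimensional k H]
  {B : Type u} [Ring B] [Algebra k B] [LeftComoduleAlgebra k H B]

lemma action_hom_ext {X : FdMod k H} {M N : FdMod k B} {f g : X ⊙ₗ M ⟶ N}
    (h : ∀ (x : X) (m : M), f.hom (x ⊗ₜ[k] m) = g.hom (x ⊗ₜ[k] m)) : f = g :=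
  hom_ext (TensorProduct.ext' h)

instance (X Y : FdMod k B) : FiniteDimensional k (X ⟶ Y) :=
  FiniteDimensional.of_injective
    (⟨⟨fun f : X ⟶ Y => f.hom, fun _ _ => rfl⟩, fun _ _ => rfl⟩ : (X ⟶ Y) →ₗ[k] (X →ₗ[k] Y))
    (hom_injective X Y)

/-- The internal Hom `Hom_B(H ⊗ M, N)`, with `H` acting by right multiplication on itself. -/
noncomputable def ihom (M N : FdMod k B) : FdMod k H where
  carrier := (reg k H ⊙ₗ M ⟶ N)
  ρ := AlgHom.ofLinearMap
    { toFun := fun h =>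
        { toFun := fun φ => orbit (reg k H) h ⊵ₗ M ≫ φ
          map_add' := fun φ ψ => Preadditive.comp_add _ _ _ _ _ _
          map_smul' := fun c φ => Linear.comp_smul _ _ _ _ _ _ }
      map_add' := fun h h' => LinearMap.ext fun φ => action_hom_ext fun (x : H) m => by
        change φ.hom ((x * (h + h') : H) ⊗ₜ[k] m) =
          φ.hom ((x * h : H) ⊗ₜ[k] m) + φ.hom ((x * h' : H) ⊗ₜ[k] m)
        rw [mul_add]
        exact (congrArg φ.hom (TensorProduct.add_tmul (x * h) (x * h') m)).trans
          (map_add φ.hom ((x * h : H) ⊗ₜ[k] m) ((x * h' : H) ⊗ₜ[k] m))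
      map_smul' := fun c h => LinearMap.ext fun φ => action_hom_ext fun (x : H) m => by
        change φ.hom ((x * (c • h) : H) ⊗ₜ[k] m) = c • φ.hom ((x * h : H) ⊗ₜ[k] m)
        rw [mul_smul_comm]
        exact map_smul φ.hom c ((x * h : H) ⊗ₜ[k] m) }
    (LinearMap.ext fun φ => action_hom_ext fun (x : H) m => by
      change φ.hom ((x * 1 : H) ⊗ₜ[k] m) = φ.hom ((x : H) ⊗ₜ[k] m)
      rw [mul_one])
    (fun h h' => LinearMap.ext fun φ => action_hom_ext fun (x : H) m => by
      change φ.hom ((x * (h * h') : H) ⊗ₜ[k] m) = φ.hom ((x * h * h' : H) ⊗ₜ[k] m)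
      rw [mul_assoc])

/-- The linear map `H ⊗ M → N` underlying an element of the internal Hom. -/
noncomputable def ihomApp (M N : FdMod k B) :
    ihom (H := H) M N →ₗ[k] (H ⊗[k] M →ₗ[k] N) where
  toFun φ := Hom.hom (X := reg k H ⊙ₗ M) φ
  map_add' _ _ := rfl
  map_smul' _ _ := rfl

lemma ihom_ext {M N : FdMod k B} {φ ψ : ihom (H := H) M N}
    (h : ∀ (a : H) (m : M), ihomApp M N φ (a ⊗ₜ[k] m) = ihomApp M N ψ (a ⊗ₜ[k] m)) : φ = ψ :=
  action_hom_ext (X := reg k H) h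

lemma ihomApp_ρ {M N : FdMod k B} (h : H) (φ : ihom (H := H) M N) (x : H) (m : M) :
    ihomApp M N ((ihom (H := H) M N).ρ h φ) (x ⊗ₜ[k] m) = ihomApp M N φ ((x * h) ⊗ₜ[k] m) := rfl

lemma ihomApp_outer {M N : FdMod k B} (φ : ihom (H := H) M N) (b : B) (t : H ⊗[k] M) :
    ihomApp M N φ (outer (Algebra.lmul k H) M.ρ (LeftComoduleAlgebra.coact b) t) =
      N.ρ b (ihomApp M N φ t) :=
  comm_apply (X := reg k H ⊙ₗ M) φ b t

/-- An element of the internal Hom from a `B`-linear map `H ⊗ M → N`. -/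
noncomputable def ihomMk {M N : FdMod k B} (f : H ⊗[k] M →ₗ[k] N)
    (hf : ∀ b t, f (outer (Algebra.lmul k H) M.ρ (LeftComoduleAlgebra.coact b) t) = N.ρ b (f t)) :
    ihom (H := H) M N :=
  (⟨f, fun b => LinearMap.ext (hf b)⟩ : Hom (reg k H ⊙ₗ M) N)

/-- The morphism `X ⟶ Hom(M, N)` given by a morphism `X ⊙ₗ M ⟶ N`. -/
noncomputable def ihomCurry {X : FdMod k H} {M N : FdMod k B} (f : X ⊙ₗ M ⟶ N) :
    X ⟶ ihom M N where
  hom :=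
    { toFun := fun x => (orbit X x ⊵ₗ M ≫ f : reg k H ⊙ₗ M ⟶ N)
      map_add' := fun x y => ihom_ext fun a m => by
        change f.hom (X.ρ a (x + y) ⊗ₜ[k] m) =
          f.hom (X.ρ a x ⊗ₜ[k] m) + f.hom (X.ρ a y ⊗ₜ[k] m)
        rw [map_add, TensorProduct.add_tmul]
        exact map_add f.hom _ _
      map_smul' := fun c x => ihom_ext fun a m => by
        change f.hom (X.ρ a (c • x) ⊗ₜ[k] m) = c • f.hom (X.ρ a x ⊗ₜ[k] m)
        rw [map_smul]
        exact map_smul f.hom c (X.ρ a x ⊗ₜ[k] m) }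
  comm h := LinearMap.ext fun x => ihom_ext fun a m => by
    change f.hom (X.ρ a (X.ρ h x) ⊗ₜ[k] m) = f.hom (X.ρ (a * h) x ⊗ₜ[k] m)
    rw [map_mul]; rfl

/-- The linear map `X ⊗ M → N`, `x ⊗ m ↦ g(x)(1 ⊗ m)` given by `g : X ⟶ Hom(M, N)`. -/
noncomputable def ihomUncurryAux {X : FdMod k H} {M N : FdMod k B} (g : X ⟶ ihom M N) :
    X ⊗[k] M →ₗ[k] N :=
  TensorProduct.lift (LinearMap.mk₂ k
    (fun x m => ihomApp M N (g.hom x) ((1 : H) ⊗ₜ[k] m))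
    (fun x y m => by rw [map_add, map_add, LinearMap.add_apply])
    (fun c x m => by rw [map_smul, map_smul, LinearMap.smul_apply])
    (fun x m n => by rw [TensorProduct.tmul_add, map_add])
    (fun c x m => by rw [TensorProduct.tmul_smul, map_smul]))

lemma ihomUncurryAux_tmul {X : FdMod k H} {M N : FdMod k B} (g : X ⟶ ihom M N) (x : X) (m : M) :
    ihomUncurryAux g (x ⊗ₜ m) = ihomApp M N (g.hom x) ((1 : H) ⊗ₜ[k] m) := rfl

/-- By `H`-linearity, `g(a x)` at `1 ⊗ m` is `g(x)` at `a ⊗ m`. This reduces `B`-linearity of the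
uncurried map to that of each `g(x)`. -/
lemma ihomUncurryAux_outer {X : FdMod k H} {M N : FdMod k B} (g : X ⟶ ihom M N)
    (t : H ⊗[k] B) (x : X) (m : M) :
    ihomUncurryAux g (outer X.ρ M.ρ t (x ⊗ₜ m)) =
      ihomApp M N (g.hom x) (outer (Algebra.lmul k H) M.ρ t ((1 : H) ⊗ₜ[k] m)) := by
  induction t with
  | zero => simp
  | add s t hs ht => simp only [map_add, LinearMap.add_apply, hs, ht]
  | tmul a b =>
    rw [outer_tmul, outer_tmul, TensorProduct.map_tmul, TensorProduct.map_tmul,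
      ihomUncurryAux_tmul, comm_apply, ihomApp_ρ, one_mul]
    simp

/-- The morphism `X ⊙ₗ M ⟶ N` given by a morphism `X ⟶ Hom(M, N)`. -/
noncomputable def ihomUncurry {X : FdMod k H} {M N : FdMod k B} (g : X ⟶ ihom M N) :
    X ⊙ₗ M ⟶ N where
  hom := ihomUncurryAux g
  comm b := TensorProduct.ext' fun x m =>
    (ihomUncurryAux_outer g (LeftComoduleAlgebra.coact b) x m).trans
      (ihomApp_outer (g.hom x) b ((1 : H) ⊗ₜ[k] m))

/-- The bijection `Hom_B(X ⊙ₗ M, N) ≃ Hom_H(X, Hom(M, N))`. -/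
noncomputable def ihomEquiv (X : FdMod k H) (M N : FdMod k B) :
    (X ⊙ₗ M ⟶ N) ≃ (X ⟶ ihom M N) where
  toFun := ihomCurry
  invFun := ihomUncurry
  left_inv f := action_hom_ext fun x m => by
    change f.hom (X.ρ 1 x ⊗ₜ[k] m) = f.hom (x ⊗ₜ[k] m)
    rw [map_one]; rfl
  right_inv g := hom_ext (LinearMap.ext fun x => ihom_ext fun a m => by
    change ihomApp M N (g.hom (X.ρ a x)) ((1 : H) ⊗ₜ[k] m) = ihomApp M N (g.hom x) (a ⊗ₜ[k] m)
    rw [comm_apply, ihomApp_ρ, one_mul])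

variable (k H B) in
/-- The bifunctor `(M, N) ↦ Hom_B(H ⊗ M, N)`. -/
noncomputable def ihomFunctor : (FdMod k B)ᵒᵖ ⥤ FdMod k B ⥤ FdMod k H where
  obj M :=
    { obj := fun N => ihom (unop M) N
      map := fun {N N'} g =>
        { hom :=
            { toFun := fun (φ : reg k H ⊙ₗ unop M ⟶ N) => (φ ≫ g : reg k H ⊙ₗ unop M ⟶ N')
              map_add' := fun φ ψ => Preadditive.add_comp _ _ _ _ _ _
              map_smul' := fun c φ => Linear.smul_comp _ _ _ _ _ _ }
          comm := fun h => rfl }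
      map_id := fun N => rfl
      map_comp := fun f g => rfl }
  map {M M'} f :=
    { app := fun N =>
        { hom :=
            { toFun := fun (φ : reg k H ⊙ₗ unop M ⟶ N) =>
                (reg k H ⊴ₗ f.unop ≫ φ : reg k H ⊙ₗ unop M' ⟶ N)
              map_add' := fun φ ψ => Preadditive.comp_add _ _ _ _ _ _
              map_smul' := fun c φ => Linear.comp_smul _ _ _ _ _ _ }
          comm := fun h => LinearMap.ext fun φ => action_hom_ext fun x m => rfl }
      naturality := fun N N' g => rfl }
  map_id M := by
    ext N : 2
    exact hom_ext (LinearMap.ext fun φ => action_hom_ext fun x m => rfl)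
  map_comp f g := by
    ext N : 2
    exact hom_ext (LinearMap.ext fun φ => action_hom_ext fun x m => rfl)

/-- The bijections `Hom_B(X ⊙ₗ M, N) ≃ Hom_H(X, Hom(M, N))` are natural in `X` and `N`. -/
noncomputable def ihomCore (M : FdMod k B) :
    Adjunction.CoreHomEquiv ((curriedAction (FdMod k H) (FdMod k B)).flip.obj M)
      ((ihomFunctor k H B).obj (op M)) where
  homEquiv X N := ihomEquiv X M N
  homEquiv_naturality_left_symm f g := action_hom_ext fun x m => rfl
  homEquiv_naturality_right f g := rfl

variable (k H B) in
/-- The internal Homs of the module category of finite-dimensional `B`-modules. -/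
noncomputable def internalHoms : InternalHoms (FdMod k H) (FdMod k B) where
  hom := ihomFunctor k H B
  adj := ParametrizedAdjunction.mk'
    (fun M => Adjunction.mkOfHomEquiv (ihomCore M))
    (fun f X N g => by
      rw [Adjunction.mkOfHomEquiv_homEquiv, Adjunction.mkOfHomEquiv_homEquiv]
      exact hom_ext (LinearMap.ext fun x => action_hom_ext fun a m => rfl))

lemma internalHoms_zeta (X : FdMod k H) (M N : FdMod k B) (f : X ⊙ₗ M ⟶ N) :
    (internalHoms k H B).zeta X M N f = ihomCurry f :=
  Equiv.congr_fun (congr_fun (congr_fun (Adjunction.mkOfHomEquiv_homEquiv (ihomCore M)) X) N) f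

lemma internalHoms_ev (M N : FdMod k B) :
    (internalHoms k H B).ev M N = ihomUncurry (𝟙 (ihom M N)) := by
  apply ((internalHoms k H B).zeta _ M N).injective
  rw [InternalHoms.zeta_ev]
  exact ((internalHoms_zeta (ihom M N) M N _).trans
    ((ihomEquiv _ M N).apply_symm_apply _)).symm

end InternalHom

end FdMod

/-! ### The end of `X ⊗ X^*` -/

namespace FdMod

section Dyad

variable {k : Type u} [Field k] {V W : Type u} [AddCommGroup V] [Module k V]
  [AddCommGroup W] [Module k W]

/-- The linear map `V ⊗ V^* → End V`, `x ⊗ f ↦ [y ↦ f(y) x]`. -/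
noncomputable def dyad : V ⊗[k] Module.Dual k V →ₗ[k] Module.End k V :=
  dualTensorHom k V V ∘ₗ (TensorProduct.comm k V (Module.Dual k V)).toLinearMap

@[simp] lemma dyad_tmul (x : V) (f : Module.Dual k V) (y : V) : dyad (x ⊗ₜ f) y = f y • x := by
  simp [dyad, dualTensorHom_apply]

lemma dyad_injective [FiniteDimensional k V] :
    Function.Injective (dyad : V ⊗[k] Module.Dual k V →ₗ[k] Module.End k V) := by
  have h : Function.Injective (dualTensorHom k V V) :=
    (dualTensorHomEquiv k V V).injective
  exact h.comp (TensorProduct.comm k V (Module.Dual k V)).injective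

/-- Under `V ⊗ V^* ≅ End V` the coevaluation corresponds to the identity, and acting on the first
factor to composition on the left. -/
lemma dyad_coevaluation [FiniteDimensional k V] (φ : Module.End k V) :
    dyad (TensorProduct.map φ LinearMap.id (coevaluation k V 1)) = φ := by
  classical
  rw [coevaluation_apply_one]
  set b := Module.Basis.ofVectorSpace k V
  ext y
  simp only [map_sum, TensorProduct.map_tmul, LinearMap.id_apply, LinearMap.sum_apply, dyad_tmul]
  conv_rhs => rw [← b.sum_repr y, map_sum]
  simp

end Dyad

/-! ### Injective and bijective morphisms of modules -/

section General

variable {k : Type u} [Field k] {A : Type u} [Ring A] [Algebra k A]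

/-- A linear map is a morphism of modules if its composite with an injective morphism is one. -/
noncomputable def homOfInjective {X Y Z : FdMod k A} (j : Y ⟶ Z) (hj : Function.Injective j.hom)
    (f : X ⟶ Z) (l : X →ₗ[k] Y) (hl : ∀ x, j.hom (l x) = f.hom x) : X ⟶ Y where
  hom := l
  comm a := LinearMap.ext fun x => hj (by
    rw [LinearMap.comp_apply, LinearMap.comp_apply, hl, comm_apply, comm_apply, hl])

lemma isIso_of_bijective {X Y : FdMod k A} (f : X ⟶ Y) (hf : Function.Bijective f.hom) :
    IsIso f :=
  (mkIso (LinearEquiv.ofBijective f.hom hf) f.comm).isIso_hom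

lemma isIso_iff_bijective {X Y : FdMod k A} (f : X ⟶ Y) :
    IsIso f ↔ Function.Bijective f.hom := by
  refine ⟨fun h => ?_, isIso_of_bijective f⟩
  refine Function.bijective_iff_has_inverse.2 ⟨(inv f).hom, fun x => ?_, fun y => ?_⟩
  · exact LinearMap.congr_fun (congrArg Hom.hom (IsIso.hom_inv_id f)) x
  · exact LinearMap.congr_fun (congrArg Hom.hom (IsIso.inv_hom_id f)) y

end General

/-! ### The adjoint representation and natural endomorphisms -/

section AdjointEnd

variable {k : Type u} [Field k] {H : Type u} [Ring H] [HopfAlgebra k H]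

lemma rightAdjointMate_hom_apply {X Y : FdMod k H} (g : X ⟶ Y) (f : Module.Dual k Y) :
    (rightAdjointMate g).hom f = (f ∘ₗ g.hom : Module.Dual k X) :=
  LinearMap.ext fun x =>
    LinearMap.congr_fun (congrArg Hom.hom (rightAdjointMate_comp_evaluation g)) (f ⊗ₜ[k] x)

/-- Read through `X ⊗ X^* ≅ End X`, the wedge condition is exactly naturality of a family of
endomorphisms. -/
lemma dyad_wedge (W : Limits.Wedge (tensorDual (FdMod k H))) {X Y : FdMod k H} (g : X ⟶ Y)
    (w : W.pt) (x : X) :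
    (dyad ((W.proj Y).hom w : Y ⊗[k] Module.Dual k Y) : Module.End k Y) (g.hom x) =
      g.hom ((dyad ((W.proj X).hom w : X ⊗[k] Module.Dual k X) : Module.End k X) x) := by
  have h := LinearMap.congr_fun (congrArg Hom.hom (W.proj_condition g)) w
  have h1 : TensorProduct.map g.hom LinearMap.id ((W.proj X).hom w : X ⊗[k] Module.Dual k X) =
      TensorProduct.map LinearMap.id (Module.Dual.transpose g.hom)
        ((W.proj Y).hom w : Y ⊗[k] Module.Dual k Y) := by
    refine Eq.trans h ?_
    change TensorProduct.map LinearMap.id (rightAdjointMate g).hom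
      ((W.proj Y).hom w : Y ⊗[k] Module.Dual k Y) = _
    congr 2
    exact LinearMap.ext fun f => rightAdjointMate_hom_apply g f
  generalize ((W.proj X).hom w : X ⊗[k] Module.Dual k X) = s at h1 ⊢
  generalize ((W.proj Y).hom w : Y ⊗[k] Module.Dual k Y) = t at h1 ⊢
  -- The wedge condition is an equation in `Y ⊗ X^*`; `D` reads it as an equation of linear maps
  -- from `X` to `Y`.
  let D : Y ⊗[k] Module.Dual k X →ₗ[k] X →ₗ[k] Y :=
    dualTensorHom k X Y ∘ₗ (TensorProduct.comm k Y (Module.Dual k X)).toLinearMap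
  have h2 : ∀ s : X ⊗[k] Module.Dual k X,
      D (TensorProduct.map g.hom LinearMap.id s) x = g.hom (dyad s x) := by
    intro s
    induction s with
    | zero => simp
    | add a b ha hb => simp only [map_add, LinearMap.add_apply, ha, hb]
    | tmul a b => simp [D, dualTensorHom_apply]
  have h3 : ∀ s : Y ⊗[k] Module.Dual k Y,
      D (TensorProduct.map LinearMap.id (Module.Dual.transpose g.hom) s) x =
        dyad s (g.hom x) := by
    intro s
    induction s with
    | zero => simp
    | add a b ha hb => simp only [map_add, LinearMap.add_apply, ha, hb]
    | tmul a b => simp [D, dualTensorHom_apply, Module.Dual.transpose_apply]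
  exact (h3 t).symm.trans ((congrArg (fun z => D z x) h1.symm).trans (h2 s))

variable (k H) in
/-- The algebra map `H ⊗ H → End H`, `g ⊗ h ↦ [a ↦ g a S(h)]`. -/
noncomputable def adAux : H ⊗[k] H →ₐ[k] Module.End k H :=
  Algebra.TensorProduct.lift (Algebra.lmul k H)
    (AlgHom.ofLinearMap ((LinearMap.mul k H).flip ∘ₗ HopfAlgebra.antipode k)
      (by ext; simp)
      (fun a b => by ext; simp [HopfAlgebra.antipode_mul_antidistrib, mul_assoc]))
    (fun a b => by
      change _ * _ = _ * _
      ext; simp [mul_assoc])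

lemma adAux_tmul (g h a : H) : adAux k H (g ⊗ₜ h) a = g * (a * HopfAlgebra.antipode k h) := by
  simp [adAux]

/-- The action of `h` on `V^*` is the transpose of `S(h)`, and a transpose slides across the
coevaluation to the right of `ρ(a)`. For `t = Δ(h)` this is the equivariance of `adjointProj` for
the adjoint action. -/
lemma outer_map_coevaluation {V : Type u} [AddCommGroup V] [Module k V] [FiniteDimensional k V]
    (ρ : H →ₐ[k] Module.End k V) (t : H ⊗[k] H) (a : H) :
    outer ρ (dualAction ρ) t (TensorProduct.map (ρ a) LinearMap.id (coevaluation k V 1)) =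
      TensorProduct.map (ρ (adAux k H t a)) LinearMap.id (coevaluation k V 1) := by
  induction t with
  | zero => simp
  | add s t hs ht =>
    simp only [map_add, LinearMap.add_apply, hs, ht, TensorProduct.map_add_left]
  | tmul g h =>
    have h1 : outer ρ (dualAction ρ) (g ⊗ₜ h)
        (TensorProduct.map (ρ a) LinearMap.id (coevaluation k V 1)) =
      TensorProduct.map (ρ g * ρ a) LinearMap.id (TensorProduct.map LinearMap.id
        (Module.Dual.transpose (ρ (HopfAlgebra.antipode k h))) (coevaluation k V 1)) := by
      rw [outer_tmul, TensorProduct.map_map, TensorProduct.map_map]; rfl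
    rw [h1, coevaluation_slide, ← LinearMap.comp_apply, ← TensorProduct.map_comp, adAux_tmul,
      map_mul, map_mul, ← mul_assoc]
    rfl

variable [FiniteDimensional k H]

variable (k H) in
/-- `H` with the adjoint action `h · a = h₍₁₎ a S(h₍₂₎)`. -/
noncomputable def adjoint : FdMod k H where
  carrier := H
  ρ := (adAux k H).comp (Bialgebra.comulAlgHom k H)

/-- The linear map `H → V ⊗ V^*` given by an action of `H` on `V`. -/
noncomputable def actionCoev {V : Type u} [AddCommGroup V] [Module k V] [FiniteDimensional k V]
    (ρ : H →ₐ[k] Module.End k V) : H →ₗ[k] V ⊗[k] Module.Dual k V :=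
  (LinearMap.rTensorHom (R := k) (N := V) (P := V) (Module.Dual k V)).flip (coevaluation k V 1) ∘ₗ
    ρ.toLinearMap

/-- The morphism `H → X ⊗ X^*` given by the action of `H` on `X`. -/
noncomputable def adjointProj (X : FdMod k H) : adjoint k H ⟶ X ⊗ X.dual where
  hom := (actionCoev X.ρ : H →ₗ[k] X ⊗[k] Module.Dual k X)
  comm h := LinearMap.ext fun (a : H) =>
    (outer_map_coevaluation X.ρ (Coalgebra.comul h) a).symm

lemma dyad_adjointProj (X : FdMod k H) (a : H) :
    dyad ((adjointProj X).hom a : X ⊗[k] Module.Dual k X) = X.ρ a :=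
  dyad_coevaluation _

lemma adjointProj_reg_injective : Function.Injective (adjointProj (reg k H)).hom := by
  intro (a : H) (b : H) h
  have h1 : (reg k H).ρ a = (reg k H).ρ b := by
    rw [← dyad_adjointProj, ← dyad_adjointProj]
    exact congrArg _ h
  have h2 : a * 1 = b * 1 := LinearMap.congr_fun h1 (1 : H)
  rwa [mul_one, mul_one] at h2

/-- The wedge condition for `adjointProj`, on bare linear maps: `q` and `g'` act on different tensor
factors, so dinaturality of the coevaluation can be used first and `g ∘ p = q ∘ g` afterwards. -/
lemma map_coevaluation_comm {V W : Type u} [AddCommGroup V] [Module k V] [FiniteDimensional k V]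
    [AddCommGroup W] [Module k W] [FiniteDimensional k W] (g : V →ₗ[k] W)
    (g' : Module.Dual k W →ₗ[k] Module.Dual k V) (p : Module.End k V) (q : Module.End k W)
    (h : TensorProduct.map LinearMap.id g' (coevaluation k W 1) =
      TensorProduct.map g LinearMap.id (coevaluation k V 1)) (hpq : g ∘ₗ p = q ∘ₗ g) :
    TensorProduct.map g LinearMap.id (TensorProduct.map p LinearMap.id (coevaluation k V 1)) =
      TensorProduct.map LinearMap.id g'
        (TensorProduct.map q LinearMap.id (coevaluation k W 1)) := by
  have h2 : TensorProduct.map LinearMap.id g'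
      (TensorProduct.map q LinearMap.id (coevaluation k W 1)) =
      TensorProduct.map q LinearMap.id
        (TensorProduct.map LinearMap.id g' (coevaluation k W 1)) := by
    rw [TensorProduct.map_map, TensorProduct.map_map]; rfl
  rw [h2, h, TensorProduct.map_map, TensorProduct.map_map, hpq]

variable (k H) in
/-- The wedge over `X ⊗ X^*` with point `H`. -/
noncomputable def adjointWedge : Limits.Wedge (tensorDual (FdMod k H)) :=
  Limits.Wedge.mk (adjoint k H) adjointProj (fun X Y g => hom_ext (LinearMap.ext fun (a : H) =>
    map_coevaluation_comm g.hom (rightAdjointMate g).hom (X.ρ a) (Y.ρ a)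
      (LinearMap.congr_fun (congrArg Hom.hom (coevaluation_comp_rightAdjointMate g)) (1 : k))
      (g.comm a)))

/-- Naturality along `a ↦ a x`, which sends `1` to `x`, shows that the component at the regular
module, evaluated at `1`, determines every other component. -/
lemma adjointProj_eq (W : Limits.Wedge (tensorDual (FdMod k H))) (X : FdMod k H) (w : W.pt) :
    (adjointProj X).hom (dyad ((W.proj (reg k H)).hom w : H ⊗[k] Module.Dual k H) (1 : H)) =
      (W.proj X).hom w := by
  apply dyad_injective (V := X)
  refine (dyad_adjointProj X _).trans (LinearMap.ext fun x => ?_)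
  have h := dyad_wedge W (orbit X x) w (1 : H)
  rw [orbit_hom_apply, map_one] at h
  exact h.symm

variable (k H) in
/-- `H` with the adjoint action is the end of `X ⊗ X^*`. -/
noncomputable def adjointWedgeIsLimit : Limits.IsLimit (adjointWedge k H) :=
  Limits.Multifork.IsLimit.mk _
    -- The lift is evaluation at `1` of the regular component. It need not be checked to be
    -- `H`-linear: its composite with the injective projection is a morphism.
    (fun W => homOfInjective (adjointProj (reg k H)) adjointProj_reg_injective
      (Limits.Wedge.proj W (reg k H))
      (LinearMap.applyₗ (1 : H) ∘ₗ dyad ∘ₗ (Limits.Wedge.proj W (reg k H)).hom)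
      (fun w => adjointProj_eq W _ w))
    (fun W X => hom_ext (LinearMap.ext fun w => adjointProj_eq W X w))
    (fun W f hf => hom_ext (LinearMap.ext fun w => adjointProj_reg_injective
      ((LinearMap.congr_fun (congrArg Hom.hom (hf (reg k H))) w).trans
        (adjointProj_eq W (reg k H) w).symm)))

end AdjointEnd

/-! ### The end of `Hom(M, M)` -/

section ComoduleEnd

open MonoidalLeftAction Opposite

variable {k : Type u} [Field k] {H : Type u} [Ring H] [HopfAlgebra k H] [FiniteDimensional k H]
  {B : Type u} [Ring B] [Algebra k B] [LeftComoduleAlgebra k H B]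

lemma comp_mulRight_mem {ξ : H →ₗ[k] B} (hξ : ξ ∈ comoduleEnd k H B) (h : H) :
    ξ ∘ₗ LinearMap.mulRight k h ∈ comoduleEnd k H B := by
  intro b x
  rw [LinearMap.comp_assoc, ← LinearMap.mulRight_mul]
  exact hξ b (x * h)

variable (k H B) in
/-- `E(H, B)` with `H` acting by `(h · ξ)(x) = ξ(x h)`. -/
noncomputable def comoduleEndObj [FiniteDimensional k B] : FdMod k H where
  carrier := comoduleEnd k H B
  ρ := AlgHom.ofLinearMap
    { toFun := fun h =>
        { toFun := fun ξ => ⟨ξ.1 ∘ₗ LinearMap.mulRight k h, comp_mulRight_mem ξ.2 h⟩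
          map_add' := fun ξ η => rfl
          map_smul' := fun c ξ => rfl }
      map_add' := fun h h' => LinearMap.ext fun ξ => Subtype.ext (LinearMap.ext fun x => by
        change ξ.1 (x * (h + h')) = ξ.1 (x * h) + ξ.1 (x * h')
        rw [mul_add, map_add])
      map_smul' := fun c h => LinearMap.ext fun ξ => Subtype.ext (LinearMap.ext fun x => by
        change ξ.1 (x * c • h) = c • ξ.1 (x * h)
        rw [mul_smul_comm, map_smul]) }
    (LinearMap.ext fun ξ => Subtype.ext (LinearMap.ext fun x => by
      change ξ.1 (x * 1) = ξ.1 x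
      rw [mul_one]))
    (fun h h' => LinearMap.ext fun ξ => Subtype.ext (LinearMap.ext fun x => by
      change ξ.1 (x * (h * h')) = ξ.1 (x * h * h')
      rw [mul_assoc]))

/-- For `t = δ(b)` the right-hand side contains the expression that defines `E(H, B)`. Thus
membership of `ξ` makes `h ⊗ m ↦ ξ(h) m` a `B`-linear map. -/
lemma lift_ρ_outer (ξ : H →ₗ[k] B) (M : FdMod k B) (t : H ⊗[k] B) (h : H) (m : M) :
    TensorProduct.lift (M.ρ.toLinearMap ∘ₗ ξ) (outer (Algebra.lmul k H) M.ρ t (h ⊗ₜ m)) =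
      M.ρ (LinearMap.mul' k B (TensorProduct.map (ξ ∘ₗ LinearMap.mulRight k h)
        LinearMap.id t)) m := by
  induction t with
  | zero => simp
  | add s t hs ht => simp only [map_add, LinearMap.add_apply, hs, ht]
  | tmul a b => simp

lemma lift_ρ_coact {ξ : H →ₗ[k] B} (hξ : ξ ∈ comoduleEnd k H B) (M : FdMod k B) (b : B)
    (t : H ⊗[k] M) :
    TensorProduct.lift (M.ρ.toLinearMap ∘ₗ ξ)
        (outer (Algebra.lmul k H) M.ρ (LeftComoduleAlgebra.coact b) t) =
      M.ρ b (TensorProduct.lift (M.ρ.toLinearMap ∘ₗ ξ) t) := by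
  induction t with
  | zero => simp
  | add s t hs ht => simp only [map_add, hs, ht]
  | tmul h m => rw [lift_ρ_outer, hξ b h, map_mul]; rfl

lemma proj_ihom_wedge (W : Limits.Wedge (ihomFunctor k H B)) {M N : FdMod k B} (g : M ⟶ N)
    (w : W.pt) (h : H) (m : M) :
    ihomApp N N ((W.proj N).hom w : ihom N N) (h ⊗ₜ[k] g.hom m) =
      g.hom (ihomApp M M ((W.proj M).hom w : ihom M M) (h ⊗ₜ[k] m)) := by
  have h1 := LinearMap.congr_fun (congrArg Hom.hom (W.proj_condition g)) w
  exact (LinearMap.congr_fun (congrArg (ihomApp (H := H) M N) h1) (h ⊗ₜ[k] m)).symm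

variable [FiniteDimensional k B]

/-- The morphism `E(H, B) ⟶ Hom(M, M)`, `ξ ↦ [h ⊗ m ↦ ξ(h) m]`. -/
noncomputable def comoduleEndProj (M : FdMod k B) : comoduleEndObj k H B ⟶ ihom M M where
  hom :=
    { toFun := fun (ξ : comoduleEnd k H B) =>
        ihomMk (TensorProduct.lift (M.ρ.toLinearMap ∘ₗ ξ.1)) (lift_ρ_coact ξ.2 M)
      map_add' := fun (ξ η : comoduleEnd k H B) => ihom_ext fun h m => by
        change M.ρ (ξ.1 h + η.1 h) m = M.ρ (ξ.1 h) m + M.ρ (η.1 h) m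
        rw [map_add]; rfl
      map_smul' := fun c (ξ : comoduleEnd k H B) => ihom_ext fun h m => by
        change M.ρ (c • ξ.1 h) m = c • M.ρ (ξ.1 h) m
        rw [map_smul]; rfl }
  comm h := LinearMap.ext fun ξ => ihom_ext fun x m => rfl

lemma comoduleEndProj_reg_injective :
    Function.Injective (comoduleEndProj (H := H) (reg k B)).hom := by
  intro (ξ : comoduleEnd k H B) (η : comoduleEnd k H B) h
  refine Subtype.ext (LinearMap.ext fun x => ?_)
  have h1 : ξ.1 x * 1 = η.1 x * 1 := LinearMap.congr_fun
    (congrArg (ihomApp (H := H) (reg k B) (reg k B)) h) (x ⊗ₜ[k] (1 : B))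
  simpa using h1

variable (k H B) in
/-- The wedge over `Hom(M, M)` with point `E(H, B)`. -/
noncomputable def comoduleEndWedge : Limits.Wedge (internalHoms k H B).hom :=
  Limits.Wedge.mk (comoduleEndObj k H B) comoduleEndProj
    (fun M N g => hom_ext (LinearMap.ext fun (ξ : comoduleEnd k H B) => ihom_ext fun h m =>
      comm_apply g (ξ.1 h) m))

/-- Naturality along `b ↦ b m` again reduces everything to the regular module. For `M = B` it says
that the regular component commutes with right multiplication by `B`. -/
lemma ihomApp_proj_eq (W : Limits.Wedge (ihomFunctor k H B)) (w : W.pt) (M : FdMod k B)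
    (h : H) (m : M) :
    ihomApp M M ((W.proj M).hom w : ihom M M) (h ⊗ₜ[k] m) =
      M.ρ (ihomApp (reg k B) (reg k B) ((W.proj (reg k B)).hom w : ihom (reg k B) (reg k B))
        (h ⊗ₜ[k] (1 : B))) m := by
  have h1 := proj_ihom_wedge W (orbit M m) w h (1 : B)
  rw [orbit_hom_apply, map_one] at h1
  exact h1

/-- Put `ξ(h) = A(h ⊗ 1)`. Left linearity equates `b ξ(h)` with `A(b₍₋₁₎ h ⊗ b₍₀₎)`, and `h1`
rewrites the latter as `ξ(b₍₋₁₎ h) b₍₀₎`. -/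
lemma comp_mk_flip_one_mem {A : H ⊗[k] B →ₗ[k] B}
    (h1 : ∀ (x : H) (b : B), A (x ⊗ₜ b) = A (x ⊗ₜ 1) * b)
    (h2 : ∀ (b : B) (t : H ⊗[k] B), A (outer (Algebra.lmul k H) (Algebra.lmul k B)
      (LeftComoduleAlgebra.coact b) t) = b * A t) :
    A ∘ₗ (TensorProduct.mk k H B).flip 1 ∈ comoduleEnd k H B := by
  intro b h
  refine Eq.trans ?_ (h2 b (h ⊗ₜ[k] (1 : B)))
  generalize (LeftComoduleAlgebra.coact b : H ⊗[k] B) = t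
  induction t with
  | zero => simp
  | add s t hs ht => simp only [map_add, LinearMap.add_apply, hs, ht]
  | tmul a b => simpa using (h1 (a * h) b).symm

lemma ihomApp_proj_mem (W : Limits.Wedge (ihomFunctor k H B)) (w : W.pt) :
    (ihomApp (reg k B) (reg k B) ((W.proj (reg k B)).hom w : ihom (reg k B) (reg k B)) :
      H ⊗[k] B →ₗ[k] B) ∘ₗ (TensorProduct.mk k H B).flip 1 ∈ comoduleEnd k H B :=
  comp_mk_flip_one_mem (ihomApp_proj_eq W w (reg k B))
    (ihomApp_outer ((W.proj (reg k B)).hom w : ihom (H := H) (reg k B) (reg k B)))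

/-- The map `W → E(H, B)` given by a wedge `W` over `Hom(M, M)`. -/
noncomputable def comoduleEndLift (W : Limits.Wedge (ihomFunctor k H B)) :
    W.pt →ₗ[k] comoduleEndObj k H B where
  toFun w := (⟨_, ihomApp_proj_mem W w⟩ : comoduleEnd k H B)
  map_add' v w := Subtype.ext (LinearMap.ext fun h => by
    change ihomApp (reg k B) (reg k B) ((W.proj (reg k B)).hom (v + w) : ihom _ _) _ = _
    rw [map_add]; rfl)
  map_smul' c w := Subtype.ext (LinearMap.ext fun h => by
    change ihomApp (reg k B) (reg k B) ((W.proj (reg k B)).hom (c • w) : ihom _ _) _ = _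
    rw [map_smul]; rfl)

lemma comoduleEndProj_eq (W : Limits.Wedge (ihomFunctor k H B)) (M : FdMod k B) (w : W.pt) :
    (comoduleEndProj M).hom (comoduleEndLift W w) = (W.proj M).hom w :=
  ihom_ext fun h m => (ihomApp_proj_eq W w M h m).symm

variable (k H B) in
/-- `E(H, B)` is the end of `Hom(M, M)`. -/
noncomputable def comoduleEndWedgeIsLimit : Limits.IsLimit (comoduleEndWedge k H B) :=
  Limits.Multifork.IsLimit.mk _
    (fun W => homOfInjective (comoduleEndProj (reg k B)) comoduleEndProj_reg_injective
      (Limits.Wedge.proj W (reg k B)) (comoduleEndLift W)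
      (fun w => comoduleEndProj_eq W _ w))
    (fun W M => hom_ext (LinearMap.ext fun w => comoduleEndProj_eq W M w))
    (fun W f hf => hom_ext (LinearMap.ext fun w => comoduleEndProj_reg_injective
      ((LinearMap.congr_fun (congrArg Hom.hom (hf (reg k B))) w).trans
        (comoduleEndProj_eq W (reg k B) w).symm)))

end ComoduleEnd

end FdMod

/-! ### Linear algebra of copairings -/

section LinearAlgebra

variable {k : Type u} [Field k] {V N P : Type u} [AddCommGroup V] [Module k V]
  [FiniteDimensional k V] [AddCommMonoid N] [Module k N] [AddCommMonoid P] [Module k P]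

variable (k V N) in
/-- The linear equivalence `V ⊗ N ≃ Hom(V^*, N)`, `v ⊗ n ↦ [f ↦ f(v) n]`. -/
noncomputable def tensorEquivDualHom : V ⊗[k] N ≃ₗ[k] (Module.Dual k V →ₗ[k] N) :=
  TensorProduct.congr (Module.evalEquiv k V) (LinearEquiv.refl k N) ≪≫ₗ
    dualTensorHomEquiv k (Module.Dual k V) N

@[simp] lemma tensorEquivDualHom_tmul (v : V) (n : N) (f : Module.Dual k V) :
    tensorEquivDualHom k V N (v ⊗ₜ n) f = f v • n := by
  simp [tensorEquivDualHom, dualTensorHom_apply]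

lemma tensorEquivDualHom_lTensor (q : N →ₗ[k] P) (z : V ⊗[k] N) (f : Module.Dual k V) :
    tensorEquivDualHom k V P (q.lTensor V z) f = q (tensorEquivDualHom k V N z f) := by
  induction z with
  | zero => simp
  | add a b ha hb => simp only [map_add, LinearMap.add_apply, ha, hb]
  | tmul a b => simp

/-- Tensoring with a vector space preserves jointly injective families of linear maps. -/
lemma lTensor_jointly_injective {ι : Type*} (q : ι → N →ₗ[k] P)
    (hq : ∀ n n', (∀ i, q i n = q i n') → n = n') {z z' : V ⊗[k] N}
    (h : ∀ i, (q i).lTensor V z = (q i).lTensor V z') : z = z' := by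
  apply (tensorEquivDualHom k V N).injective
  ext f
  apply hq
  intro i
  rw [← tensorEquivDualHom_lTensor, ← tensorEquivDualHom_lTensor, h]

end LinearAlgebra

/-! ### Convolution and the equation for the copairing -/

section Convolution

open WithConv

variable {k : Type u} [Field k] {H : Type u} [Ring H] [HopfAlgebra k H] {B : Type u} [Ring B]
  [Algebra k B]

/-- The linear map `h ↦ (h₍₁₎ ⊗ 1) F(h₍₂₎)`. -/
noncomputable def leftConv (F : H →ₗ[k] H ⊗[k] B) : H →ₗ[k] H ⊗[k] B :=
  (toConv (Algebra.TensorProduct.includeLeft : H →ₐ[k] H ⊗[k] B).toLinearMap * toConv F).ofConv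

/-- The linear map `h ↦ (S(h₍₁₎) ⊗ 1) F(h₍₂₎)`. -/
noncomputable def leftConvAntipode (F : H →ₗ[k] H ⊗[k] B) : H →ₗ[k] H ⊗[k] B :=
  (toConv ((Algebra.TensorProduct.includeLeft : H →ₐ[k] H ⊗[k] B).toLinearMap ∘ₗ
    HopfAlgebra.antipode k) * toConv F).ofConv

/-- The convolution identity `id * S = 1` in `End H`, pushed forward along the algebra map `a ↦ a ⊗
1`. -/
lemma includeLeft_conv_antipode :
    toConv (Algebra.TensorProduct.includeLeft : H →ₐ[k] H ⊗[k] B).toLinearMap *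
      toConv ((Algebra.TensorProduct.includeLeft : H →ₐ[k] H ⊗[k] B).toLinearMap ∘ₗ
        HopfAlgebra.antipode k) = 1 := by
  have h := LinearMap.algHom_comp_convMul_distrib
    (Algebra.TensorProduct.includeLeft : H →ₐ[k] H ⊗[k] B)
    (toConv LinearMap.id) (toConv (HopfAlgebra.antipode k (A := H)))
  rw [LinearMap.id_mul_antipode] at h
  refine (congrArg toConv h).symm.trans ?_
  rw [LinearMap.convOne_def, LinearMap.convOne_def]
  congr 1

lemma antipode_conv_includeLeft :
    toConv ((Algebra.TensorProduct.includeLeft : H →ₐ[k] H ⊗[k] B).toLinearMap ∘ₗ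
        HopfAlgebra.antipode k) *
      toConv (Algebra.TensorProduct.includeLeft : H →ₐ[k] H ⊗[k] B).toLinearMap = 1 := by
  have h := LinearMap.algHom_comp_convMul_distrib
    (Algebra.TensorProduct.includeLeft : H →ₐ[k] H ⊗[k] B)
    (toConv (HopfAlgebra.antipode k (A := H))) (toConv LinearMap.id)
  rw [LinearMap.antipode_mul_id] at h
  refine (congrArg toConv h).symm.trans ?_
  rw [LinearMap.convOne_def, LinearMap.convOne_def]
  congr 1

lemma leftConv_leftConvAntipode (F : H →ₗ[k] H ⊗[k] B) : leftConv (leftConvAntipode F) = F := by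
  rw [leftConv, leftConvAntipode, toConv_ofConv, ← mul_assoc, includeLeft_conv_antipode, one_mul]

lemma leftConvAntipode_leftConv (F : H →ₗ[k] H ⊗[k] B) : leftConvAntipode (leftConv F) = F := by
  rw [leftConv, leftConvAntipode, toConv_ofConv, ← mul_assoc, antipode_conv_includeLeft, one_mul]

lemma leftConv_apply (F : H →ₗ[k] H ⊗[k] B) (h : H) :
    leftConv F h = LinearMap.mul' k (H ⊗[k] B) (TensorProduct.map
      (Algebra.TensorProduct.includeLeft : H →ₐ[k] H ⊗[k] B).toLinearMap F
        (Coalgebra.comul h)) := rfl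

/-- This exhibits `conjK` as the convolution of `S` with `h ↦ K (h ⊗ 1)`, so that convolution with
the inclusion of `H` undoes it. -/
lemma sandwich_comul (z : H ⊗[k] B) : sandwich z ∘ₗ Coalgebra.comul =
    leftConvAntipode (LinearMap.mulLeft k z ∘ₗ
      (Algebra.TensorProduct.includeLeft : H →ₐ[k] H ⊗[k] B).toLinearMap) := by
  refine LinearMap.ext fun h => ?_
  change sandwich z (Coalgebra.comul h) = LinearMap.mul' k (H ⊗[k] B) (TensorProduct.map _ _
    (Coalgebra.comul h))
  generalize (Coalgebra.comul h : H ⊗[k] H) = t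
  induction t with
  | zero => simp
  | add s t hs ht => simp only [map_add, hs, ht]
  | tmul a c => simp [sandwich_tmul, mul_assoc]

variable [LeftComoduleAlgebra k H B]

/-- For `s = a ⊗ ξ`, the linear map `h ↦ a ⊗ ξ(h)`. -/
noncomputable def evalEnd (s : H ⊗[k] comoduleEnd k H B) : H →ₗ[k] H ⊗[k] B :=
  (LinearMap.lTensorHom H ∘ₗ (comoduleEnd k H B).subtype.flip).flip s

lemma evalEnd_apply (s : H ⊗[k] comoduleEnd k H B) (h : H) :
    evalEnd s h = ((comoduleEnd k H B).subtype.flip h).lTensor H s := rfl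

lemma evalEnd_injective [FiniteDimensional k H] {s s' : H ⊗[k] comoduleEnd k H B}
    (h : evalEnd s = evalEnd s') : s = s' :=
  lTensor_jointly_injective (fun h => (comoduleEnd k H B).subtype.flip h)
    (fun ξ η hh => Subtype.ext (LinearMap.ext hh)) (fun x => LinearMap.congr_fun h x)

/-- For `s = a ⊗ ξ`, the linear map `h ↦ a S(h₍₁₎) ⊗ ξ(h₍₂₎)`. -/
noncomputable def convEnd (s : H ⊗[k] comoduleEnd k H B) : H →ₗ[k] H ⊗[k] B :=
  (LinearMap.mul' k (H ⊗[k] B) ∘ₗ (TensorProduct.comm k _ _).toLinearMap ∘ₗ TensorProduct.map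
    ((Algebra.TensorProduct.includeLeft : H →ₐ[k] H ⊗[k] B).toLinearMap ∘ₗ
      HopfAlgebra.antipode k) (evalEnd s)) ∘ₗ Coalgebra.comul

lemma convEnd_tmul (a : H) (ξ : comoduleEnd k H B) (h : H) :
    convEnd (a ⊗ₜ ξ) h =
      TensorProduct.map (LinearMap.mulLeft k a ∘ₗ HopfAlgebra.antipode k) ξ.1
        (Coalgebra.comul h) := by
  change (LinearMap.mul' k (H ⊗[k] B) ∘ₗ (TensorProduct.comm k _ _).toLinearMap ∘ₗ
    TensorProduct.map _ _) (Coalgebra.comul h) = _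
  generalize (Coalgebra.comul h : H ⊗[k] H) = t
  induction t with
  | zero => simp
  | add s t hs ht => simp only [map_add, hs, ht]
  | tmul g g' => simp [evalEnd_apply]

lemma convEnd_add (s t : H ⊗[k] comoduleEnd k H B) :
    convEnd (s + t) = convEnd s + convEnd t := by
  simp only [convEnd, evalEnd, map_add, TensorProduct.map_add_right, LinearMap.comp_add,
    LinearMap.add_comp]

lemma convEnd_zero : convEnd (0 : H ⊗[k] comoduleEnd k H B) = 0 := by
  simp only [convEnd, evalEnd, map_zero, TensorProduct.map_zero_right, LinearMap.comp_zero,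
    LinearMap.zero_comp]

variable (B) in
/-- `S ⊗ id` on `H ⊗ B`. -/
noncomputable abbrev antipodeLeft : H ⊗[k] B →ₗ[k] H ⊗[k] B :=
  (HopfAlgebra.antipode k).rTensor B

lemma antipodeLeft_mul (g : H) (z : H ⊗[k] B) :
    antipodeLeft B z * (HopfAlgebra.antipode k g ⊗ₜ 1) = antipodeLeft B ((g ⊗ₜ 1) * z) := by
  induction z with
  | zero => simp
  | add s t hs ht => simp only [map_add, mul_add, add_mul, hs, ht]
  | tmul a b => simp [HopfAlgebra.antipode_mul_antidistrib]

/-- In `convEnd` the factor `S(h₍₁₎)` stands on the right, against the order of the convolution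
product. Pulling `S ⊗ id` out reverses products and puts `h₍₁₎` on the left, which gives the genuine
convolution `leftConv F`. -/
lemma convEnd_of_evalEnd {s : H ⊗[k] comoduleEnd k H B} {F : H →ₗ[k] H ⊗[k] B}
    (h : evalEnd s = antipodeLeft B ∘ₗ F) : convEnd s = antipodeLeft B ∘ₗ leftConv F := by
  refine LinearMap.ext fun x => ?_
  rw [LinearMap.comp_apply, leftConv_apply, convEnd, h, LinearMap.comp_apply]
  generalize (Coalgebra.comul x : H ⊗[k] H) = t
  induction t with
  | zero => simp
  | add s t hs ht => simp only [map_add, hs, ht]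
  | tmul g g' => exact antipodeLeft_mul g (F g')

variable [FiniteDimensional k H] [QuasitriangularHopfAlgebra k H]

variable (k H B) in
lemma antipodeLeft_bijective : Function.Bijective (antipodeLeft (k := k) (H := H) B) :=
  (TensorProduct.congr (LinearEquiv.ofBijective _ (FdMod.antipode_bijective k H))
    (LinearEquiv.refl k B)).bijective

lemma exists_antipodeLeft_comp (G : H →ₗ[k] H ⊗[k] B) :
    ∃ F : H →ₗ[k] H ⊗[k] B, G = antipodeLeft B ∘ₗ F := by
  let e := LinearEquiv.ofBijective _ (antipodeLeft_bijective k H B)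
  exact ⟨e.symm.toLinearMap ∘ₗ G, LinearMap.ext fun x => (e.apply_symm_apply (G x)).symm⟩

/-- Cancellation of `S(h₍₁₎)`. Bijectivity of `S` allows `evalEnd s` to be written as `(S ⊗ id) ∘
V`; the equation becomes `leftConv V = F`, and `leftConv` is invertible. -/
lemma convEnd_eq_iff (s : H ⊗[k] comoduleEnd k H B) (F : H →ₗ[k] H ⊗[k] B) :
    convEnd s = antipodeLeft B ∘ₗ F ↔ evalEnd s = antipodeLeft B ∘ₗ leftConvAntipode F := by
  constructor
  · intro h
    obtain ⟨V, hV⟩ := exists_antipodeLeft_comp (evalEnd s)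
    have h1 := (convEnd_of_evalEnd hV).symm.trans h
    have h2 : leftConv V = F := LinearMap.ext fun x =>
      (antipodeLeft_bijective k H B).1 (LinearMap.congr_fun h1 x)
    rw [hV, ← h2, leftConvAntipode_leftConv]
  · intro h
    rw [convEnd_of_evalEnd h, leftConv_leftConvAntipode]

lemma convEnd_injective {s s' : H ⊗[k] comoduleEnd k H B} (h : convEnd s = convEnd s') :
    s = s' := by
  obtain ⟨F, hF⟩ := exists_antipodeLeft_comp (convEnd s')
  rw [hF] at h
  exact evalEnd_injective (((convEnd_eq_iff s F).1 h).trans ((convEnd_eq_iff s' F).1 hF).symm)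

variable [QuasitriangularComoduleAlgebra k H B]

open QuasitriangularComoduleAlgebra (K)

lemma convEnd_eq_K_iff (s : H ⊗[k] comoduleEnd k H B) :
    (∀ h, convEnd s h = antipodeLeft B ((K (k := k) (H := H) (B := B) : H ⊗[k] B) * (h ⊗ₜ 1))) ↔
      evalEnd s = antipodeLeft B ∘ₗ conjK k H B := by
  rw [conjK, sandwich_comul, ← convEnd_eq_iff]
  exact ⟨fun h => LinearMap.ext h, fun h x => LinearMap.congr_fun h x⟩

/-- Applying `f` to the first leg of `S(S(h₍₁₎) Kᵢ h₍₂₎) ⊗ Kⁱ` gives the value at `h` of `θ_B(f ∘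
S)`. -/
lemma theta_comp_antipode {s : H ⊗[k] comoduleEnd k H B}
    (h : evalEnd s = antipodeLeft B ∘ₗ conjK k H B) (f : Module.Dual k H) :
    tensorEquivDualHom k H (comoduleEnd k H B) s f =
      theta k H B (f ∘ₗ HopfAlgebra.antipode k) := by
  refine Subtype.ext (LinearMap.ext fun x => ?_)
  have h1 := LinearMap.congr_fun h x
  have h2 := tensorEquivDualHom_lTensor ((comoduleEnd k H B).subtype.flip x) s f
  refine h2.symm.trans ?_
  rw [← evalEnd_apply, h1]
  change _ = TensorProduct.lid k B (TensorProduct.map (f ∘ₗ HopfAlgebra.antipode k) LinearMap.id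
    (conjK k H B x))
  rw [LinearMap.comp_apply]
  generalize conjK k H B x = z
  induction z with
  | zero => simp
  | add s t hs ht => simp only [map_add, LinearMap.add_apply, hs, ht]
  | tmul a b => simp

variable (k H B) in
-- Existence of the copairing as an element: since `θ_B` takes values in `E(H, B)`, the map `f ↦
-- θ_B(f ∘ S)` lies in `Hom(H^*, E(H, B)) ≅ H ⊗ E(H, B)`.
lemma exists_evalEnd_eq : ∃ s : H ⊗[k] comoduleEnd k H B,
    evalEnd s = antipodeLeft B ∘ₗ conjK k H B := by
  obtain ⟨s, hs⟩ := (tensorEquivDualHom k H (comoduleEnd k H B)).surjective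
    (theta k H B ∘ₗ (HopfAlgebra.antipode k).dualMap)
  refine ⟨s, LinearMap.ext fun x => (tensorEquivDualHom k H B).injective
    (LinearMap.ext fun f => ?_)⟩
  rw [evalEnd_apply, tensorEquivDualHom_lTensor, hs]
  change TensorProduct.lid k B (TensorProduct.map (f ∘ₗ HopfAlgebra.antipode k) LinearMap.id
    (conjK k H B x)) = _
  rw [LinearMap.comp_apply]
  generalize conjK k H B x = z
  induction z with
  | zero => simp
  | add s t hs ht => simp only [map_add, LinearMap.add_apply, hs, ht]
  | tmul a b => simp

end Convolution

/-! ### The universal copairing -/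

namespace FdMod

open MonoidalLeftAction Opposite

variable {k : Type u} [Field k] {H : Type u} [Ring H] [HopfAlgebra k H] [FiniteDimensional k H]
  {B : Type u} [Ring B] [Algebra k B] [LeftComoduleAlgebra k H B]

lemma internalHoms_coev_apply (M : FdMod k B) (h : H) (m : M) :
    ihomApp M M (((internalHoms k H B).coev M).hom (1 : k) : ihom M M) (h ⊗ₜ[k] m) =
      Coalgebra.counit (R := k) h • m := by
  have h1 : (internalHoms k H B).coev M = ihomCurry (λₗ M).hom := internalHoms_zeta _ _ _ _
  rw [h1]
  change (Coalgebra.counit (R := k) h • (1 : k)) • m = _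
  rw [smul_eq_mul, mul_one]

lemma assoc_ev_outer (Y : FdMod k H) (M N : FdMod k B) (y : Y) (φ : ihom (H := H) M N) (m : M)
    (t : H ⊗[k] H) :
    TensorProduct.map LinearMap.id (ihomUncurryAux (𝟙 (ihom M N)))
      (TensorProduct.assoc k Y (ihom (H := H) M N) M
        (outer Y.ρ (ihom (H := H) M N).ρ t (y ⊗ₜ φ) ⊗ₜ m)) =
      TensorProduct.map (Y.ρ.toLinearMap.flip y)
        (ihomApp M N φ ∘ₗ (TensorProduct.mk k H M).flip m) t := by
  induction t with
  | zero => simp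
  | add s t hs ht =>
    simp only [map_add, LinearMap.add_apply, TensorProduct.add_tmul, hs, ht]
  | tmul a b =>
    rw [outer_tmul, TensorProduct.map_tmul, TensorProduct.assoc_tmul, TensorProduct.map_tmul,
      ihomUncurryAux_tmul, id_hom, LinearMap.id_apply, LinearMap.id_apply, ihomApp_ρ, one_mul]
    rfl

/-- Currying lets `h` act on `y ⊗ φ` through `Δ(h)`, and `ev` evaluates at `1`, where `h₍₂₎ φ` takes
the value `φ(h₍₂₎ ⊗ m)`. The result is `h₍₁₎ y ⊗ φ(h₍₂₎ ⊗ m)`. -/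
lemma ihomApp_tensorComparison (Y : FdMod k H) (M N : FdMod k B) (y : Y) (φ : ihom (H := H) M N)
    (h : H) (m : M) :
    ihomApp M (Y ⊙ₗ N)
      (((internalHoms k H B).tensorComparison Y M N).hom (y ⊗ₜ[k] φ) : ihom M (Y ⊙ₗ N))
        (h ⊗ₜ[k] m) =
      TensorProduct.map (Y.ρ.toLinearMap.flip y)
        (ihomApp M N φ ∘ₗ (TensorProduct.mk k H M).flip m) (Coalgebra.comul h) := by
  have h1 : (internalHoms k H B).tensorComparison Y M N =
      ihomCurry ((αₗ Y (ihom M N) M).hom ≫ Y ⊴ₗ ihomUncurry (𝟙 (ihom M N))) := by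
    refine (internalHoms_zeta (Y ⊗ ihom M N) _ _ _).trans ?_
    rw [internalHoms_ev]
    rfl
  rw [h1]
  exact assoc_ev_outer Y M N y φ m (Coalgebra.comul h)

variable (X : FdMod k H) (M : FdMod k B)

/-- The linear map `H ⊗ M → X^* ⊗ M` underlying an element of `Hom(M, X^* ⊙ₗ M)`. -/
noncomputable def ihomAppDual :
    ihom (H := H) M (X.dual ⊙ₗ M) →ₗ[k] (H ⊗[k] M →ₗ[k] Module.Dual k X ⊗[k] M) :=
  ihomApp M (X.dual ⊙ₗ M)

/-- The linear map `X^* ⊗ Hom(M, M) → Hom(M, X^* ⊙ₗ M)` underlying the canonical isomorphism. -/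
noncomputable def dualComparison :
    Module.Dual k X ⊗[k] ihom (H := H) M M →ₗ[k] ihom (H := H) M (X.dual ⊙ₗ M) :=
  ((internalHoms k H B).tensorComparison X.dual M M).hom

variable {X M}

lemma ihomAppDual_dualComparison (f : Module.Dual k X) (φ : ihom (H := H) M M) (h : H) (m : M) :
    ihomAppDual X M (dualComparison X M (f ⊗ₜ φ)) (h ⊗ₜ m) =
      TensorProduct.map ((dualAction X.ρ).toLinearMap.flip f)
        (ihomApp M M φ ∘ₗ (TensorProduct.mk k H M).flip m) (Coalgebra.comul h) :=
  ihomApp_tensorComparison X.dual M M f φ h m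

/-- The value at `x` of the linear map `X → M` given by `φ(h ⊗ m) ∈ X^* ⊗ M`. -/
noncomputable def evalAt (x : X) (h : H) (m : M) : ihom (H := H) M (X.dual ⊙ₗ M) →ₗ[k] M :=
  LinearMap.applyₗ x ∘ₗ dualTensorHom k X M ∘ₗ LinearMap.applyₗ (h ⊗ₜ[k] m) ∘ₗ ihomAppDual X M

lemma evalAt_apply (x : X) (h : H) (m : M) (φ : ihom (H := H) M (X.dual ⊙ₗ M)) :
    evalAt x h m φ = dualTensorHom k X M (ihomAppDual X M φ (h ⊗ₜ[k] m)) x := rfl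

lemma ihom_ext_evalAt {φ ψ : ihom (H := H) M (X.dual ⊙ₗ M)}
    (h : ∀ (x : X) (h : H) (m : M), evalAt x h m φ = evalAt x h m ψ) : φ = ψ :=
  ihom_ext fun a m => (dualTensorHomEquiv k X M).injective (LinearMap.ext fun x => h x a m)

/-- Elements of `X ⊗ Hom(M, X^* ⊙ₗ M)` are separated by evaluation. -/
lemma tensor_ihom_ext {X : FdMod k H} {M : FdMod k B}
    {z z' : X ⊗[k] ihom (H := H) M (X.dual ⊙ₗ M)}
    (h : ∀ (x : X) (h : H) (m : M),
      (evalAt x h m).lTensor X z = (evalAt x h m).lTensor X z') : z = z' :=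
  lTensor_jointly_injective (fun i : X × H × M => evalAt (X := X) (M := M) i.1 i.2.1 i.2.2)
    (fun _ _ hh => ihom_ext_evalAt fun x h m => hh (x, h, m)) (fun i => h i.1 i.2.1 i.2.2)

lemma outer_apply_tmul {V W : Type u} [AddCommGroup V] [Module k V] [AddCommGroup W] [Module k W]
    (ρ : H →ₐ[k] Module.End k V) (σ : B →ₐ[k] Module.End k W) (t : H ⊗[k] B) (x : V) (m : W) :
    outer ρ σ t (x ⊗ₜ m) =
      TensorProduct.map (ρ.toLinearMap.flip x) (σ.toLinearMap.flip m) t := by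
  induction t with
  | zero => simp
  | add s t hs ht => simp only [map_add, LinearMap.add_apply, hs, ht]
  | tmul a b => simp

/-- The canonical map `X ⊗ X^* ⊗ Hom(M, M) → X ⊗ Hom(M, X^* ⊙ₗ M)`. -/
noncomputable def tensorDualComparison (X : FdMod k H) (M : FdMod k B) :
    (X ⊗[k] Module.Dual k X) ⊗[k] ihom (H := H) M M →ₗ[k]
      X ⊗[k] ihom (H := H) M (X.dual ⊙ₗ M) :=
  (dualComparison X M).lTensor X ∘ₗ
    (TensorProduct.assoc k X (Module.Dual k X) (ihom (H := H) M M)).toLinearMap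

lemma tensorDualComparison_tmul (x' : X) (f : Module.Dual k X) (φ : ihom (H := H) M M) :
    tensorDualComparison X M ((x' ⊗ₜ f) ⊗ₜ φ) = x' ⊗ₜ dualComparison X M (f ⊗ₜ φ) := rfl

/-- The antipode comes from the action on `X^*`: `⟨h₍₁₎ f, x⟩ = ⟨f, S(h₍₁₎) x⟩`. -/
lemma evalAt_tensorDualComparison (x : X) (h : H) (m : M) (u : X ⊗[k] Module.Dual k X)
    (φ : ihom (H := H) M M) :
    (evalAt x h m).lTensor X (tensorDualComparison X M (u ⊗ₜ φ)) =
      TensorProduct.map (dyad u ∘ₗ (X.ρ.toLinearMap ∘ₗ HopfAlgebra.antipode k).flip x)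
        (ihomApp M M φ ∘ₗ (TensorProduct.mk k H M).flip m) (Coalgebra.comul h) := by
  induction u with
  | zero => simp
  | add u v hu hv =>
    rw [TensorProduct.add_tmul, map_add, map_add, hu, hv, map_add, LinearMap.add_comp,
      TensorProduct.map_add_left, LinearMap.add_apply]
  | tmul x' f =>
    rw [tensorDualComparison_tmul, LinearMap.lTensor_tmul, evalAt_apply,
      ihomAppDual_dualComparison]
    generalize (Coalgebra.comul h : H ⊗[k] H) = t
    induction t with
    | zero => simp
    | add s t hs ht =>
      simp only [map_add, LinearMap.add_apply, TensorProduct.tmul_add, hs, ht]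
    | tmul a b =>
      rw [TensorProduct.map_tmul, TensorProduct.map_tmul, dualTensorHom_apply,
        LinearMap.comp_apply (dyad _), dyad_tmul, TensorProduct.tmul_smul, TensorProduct.smul_tmul']
      rfl

/-- Since `φ` depends on `h` only through the counit, `h` acts on `X^*` alone, followed by `z` on
`X^* ⊗ M`; evaluation at `x` then transfers the first leg of `z (h ⊗ 1)` to `X` by the antipode. The
data `e`, `φ`, `u` are abstract so that the tensors can be decomposed. -/
lemma evalAt_coev (x : X) (h : H) (m : M) (z : H ⊗[k] B)
    (e : ihom (H := H) M (X.dual ⊙ₗ M) →ₗ[k] ihom (H := H) M (X.dual ⊙ₗ M))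
    (he : ∀ φ t, ihomAppDual X M (e φ) t = outer (dualAction X.ρ) M.ρ z (ihomAppDual X M φ t))
    (φ : ihom (H := H) M M)
    (hφ : ∀ (h : H) (m : M), ihomApp M M φ (h ⊗ₜ m) = Coalgebra.counit (R := k) h • m)
    (u : X ⊗[k] Module.Dual k X) :
    (evalAt x h m).lTensor X (e.lTensor X (tensorDualComparison X M (u ⊗ₜ φ))) =
      TensorProduct.map (dyad u) LinearMap.id
        (outer X.ρ M.ρ (antipodeLeft B (z * (h ⊗ₜ 1))) (x ⊗ₜ m)) := by
  induction u with
  | zero => simp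
  | add u v hu hv =>
    rw [TensorProduct.add_tmul, map_add, map_add, map_add, hu, hv, map_add,
      TensorProduct.map_add_left, LinearMap.add_apply]
  | tmul x' f =>
    have h1 : TensorProduct.map ((dualAction X.ρ).toLinearMap.flip f)
        (ihomApp M M φ ∘ₗ (TensorProduct.mk k H M).flip m) (Coalgebra.comul h) =
        dualAction X.ρ h f ⊗ₜ m := by
      have h2 : ihomApp M M φ ∘ₗ (TensorProduct.mk k H M).flip m =
          LinearMap.toSpanSingleton k M m ∘ₗ Coalgebra.counit :=
        LinearMap.ext fun a => hφ a m
      rw [h2]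
      have h3 := congrArg (TensorProduct.map ((dualAction X.ρ).toLinearMap.flip f)
        (LinearMap.toSpanSingleton k M m)) (Coalgebra.lTensor_counit_comul (R := k) h)
      rw [LinearMap.lTensor, TensorProduct.map_map, LinearMap.comp_id] at h3
      rw [h3]
      simp
    rw [tensorDualComparison_tmul, LinearMap.lTensor_tmul, LinearMap.lTensor_tmul, evalAt_apply,
      he, ihomAppDual_dualComparison, h1]
    -- The hypothesis `he` ties `e` to this particular `z`, so it must go before the induction on
    -- `z`.
    clear he
    induction z with
    | zero => simp
    | add s t hs ht =>
      simp only [map_add, add_mul, LinearMap.add_apply, TensorProduct.tmul_add, hs, ht]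
    | tmul a b =>
      rw [outer_tmul, TensorProduct.map_tmul, dualTensorHom_apply, TensorProduct.tmul_smul,
        TensorProduct.smul_tmul', Algebra.TensorProduct.tmul_mul_tmul, LinearMap.rTensor_tmul,
        outer_tmul, TensorProduct.map_tmul, TensorProduct.map_tmul, dyad_tmul, mul_one,
        HopfAlgebra.antipode_mul_antidistrib, map_mul]
      rfl

variable [FiniteDimensional k B]

/-- The linear map `E(H, B) → Hom(M, M)`, `ξ ↦ [h ⊗ m ↦ ξ(h) m]`. -/
noncomputable def comoduleEndProjLin (M : FdMod k B) :
    comoduleEnd k H B →ₗ[k] ihom (H := H) M M :=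
  (comoduleEndProj M).hom

/-- For `s = a ⊗ ξ` the endomorphism attached to `actionCoev` is the action of `a`, so the value is
`a S(h₍₁₎) x ⊗ ξ(h₍₂₎) m`. -/
lemma evalAt_end (x : X) (h : H) (m : M) (s : H ⊗[k] comoduleEnd k H B) :
    (evalAt x h m).lTensor X (tensorDualComparison X M
      (TensorProduct.map (actionCoev X.ρ) (comoduleEndProjLin M) s)) =
      outer X.ρ M.ρ (convEnd s h) (x ⊗ₜ m) := by
  induction s with
  | zero => simp [convEnd_zero]
  | add s t hs ht => simp only [map_add, convEnd_add, LinearMap.add_apply, hs, ht]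
  | tmul a ξ =>
    have h1 : actionCoev X.ρ a = TensorProduct.map (X.ρ a) LinearMap.id (coevaluation k X 1) := rfl
    rw [TensorProduct.map_tmul, h1, evalAt_tensorDualComparison, dyad_coevaluation, convEnd_tmul,
      outer_apply_tmul, TensorProduct.map_map]
    congr 2
    ext y
    change X.ρ a (X.ρ (HopfAlgebra.antipode k y) x) = X.ρ (a * HopfAlgebra.antipode k y) x
    rw [map_mul]; rfl

variable [QuasitriangularHopfAlgebra k H]

/-- The morphism `E_C ⊗ E_M ⟶ X ⊗ Hom(M, X^* ⊙ₗ M)` in the definition of the universal copairing. -/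
noncomputable def copairingTest (X : FdMod k H) (M : FdMod k B) :
    adjoint k H ⊗ comoduleEndObj k H B ⟶ X ⊗ ihom M (X.dual ⊙ₗ M) :=
  (adjointProj X ⊗ₘ comoduleEndProj M) ≫ (α_ X X.dual (ihom M M)).hom ≫
    X ◁ (internalHoms k H B).tensorComparison X.dual M M

lemma copairingTest_apply (s : H ⊗[k] comoduleEnd k H B) :
    (copairingTest X M).hom s = tensorDualComparison X M
      (TensorProduct.map (actionCoev X.ρ) (comoduleEndProjLin M) s) := rfl

lemma outer_lmul_one (t : H ⊗[k] B) :
    outer (Algebra.lmul k H) (Algebra.lmul k B) t (1 ⊗ₜ 1) = t := by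
  induction t with
  | zero => simp
  | add s t hs ht => rw [map_add, LinearMap.add_apply, hs, ht]
  | tmul a b => simp

lemma evalAt_copairingTest_reg (s : H ⊗[k] comoduleEnd k H B) (a : H) :
    (evalAt (X := reg k H) (M := reg k B) (1 : H) a (1 : B)).lTensor (reg k H)
      ((copairingTest (reg k H) (reg k B)).hom s) = convEnd s a :=
  (evalAt_end (X := reg k H) (M := reg k B) (1 : H) a (1 : B) s).trans (outer_lmul_one _)

/-- The regular pair already determines `s`, because evaluation at `x = m = 1` recovers `convEnd s`.
-/
lemma copairingTest_reg_injective :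
    Function.Injective (copairingTest (reg k H) (reg k B)).hom := by
  intro (s : H ⊗[k] comoduleEnd k H B) (s' : H ⊗[k] comoduleEnd k H B) h
  refine convEnd_injective (LinearMap.ext fun a => ?_)
  rw [← evalAt_copairingTest_reg, ← evalAt_copairingTest_reg]
  exact congrArg _ h

variable [QuasitriangularComoduleAlgebra k H B]

open QuasitriangularComoduleAlgebra (K)

/-- The morphism `𝟙 ⟶ X ⊗ Hom(M, X^* ⊙ₗ M)` that defines the universal copairing. -/
noncomputable def copairingTarget (X : FdMod k H) (M : FdMod k B) :
    𝟙_ (FdMod k H) ⟶ X ⊗ ihom M (X.dual ⊙ₗ M) :=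
  (λ_ (𝟙_ (FdMod k H))).inv ≫ (coev X ⊗ₘ (internalHoms k H B).coev M) ≫
    (α_ X X.dual (ihom M M)).hom ≫ X ◁ (internalHoms k H B).tensorComparison X.dual M M ≫
      X ◁ ((internalHoms k H B).hom.obj (op M)).map (moduleBraidingIso X.dual M).hom

lemma evalAt_copairingTarget (x : X) (h : H) (m : M) :
    (evalAt x h m).lTensor X ((copairingTarget X M).hom (1 : k)) =
      outer X.ρ M.ρ (antipodeLeft B ((K (k := k) (H := H) (B := B) : H ⊗[k] B) * (h ⊗ₜ 1)))
        (x ⊗ₜ m) := by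
  have h1 := evalAt_coev x h m (K (k := k) (H := H) (B := B) : H ⊗[k] B)
    (((internalHoms k H B).hom.obj (op M)).map (moduleBraidingIso X.dual M).hom).hom
    (fun φ t => rfl) (((internalHoms k H B).coev M).hom (1 : k)) (internalHoms_coev_apply M)
    (coevaluation k X 1)
  refine Eq.trans h1 ?_
  have h2 := dyad_coevaluation (LinearMap.id : X →ₗ[k] X)
  rw [TensorProduct.map_id, LinearMap.id_apply] at h2
  rw [h2, TensorProduct.map_id, LinearMap.id_apply]

lemma copairingTest_eq_target {s : H ⊗[k] comoduleEnd k H B}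
    (h : evalEnd s = antipodeLeft B ∘ₗ conjK k H B) (X : FdMod k H) (M : FdMod k B) :
    (copairingTest X M).hom s = (copairingTarget X M).hom (1 : k) := by
  refine tensor_ihom_ext fun x a m => ?_
  rw [copairingTest_apply]
  refine (evalAt_end x a m s).trans ?_
  rw [(convEnd_eq_K_iff s).2 h a]
  exact (evalAt_copairingTarget x a m).symm

lemma evalEnd_eq_of_copairingTest {s : H ⊗[k] comoduleEnd k H B}
    (h : (copairingTest (reg k H) (reg k B)).hom s =
      (copairingTarget (reg k H) (reg k B)).hom (1 : k)) :
    evalEnd s = antipodeLeft B ∘ₗ conjK k H B := by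
  refine (convEnd_eq_K_iff s).1 fun a => ?_
  rw [← evalAt_copairingTest_reg, h]
  exact (evalAt_copairingTarget (X := reg k H) (M := reg k B) (1 : H) a (1 : B)).trans
    (outer_lmul_one _)

/-- Definitional in the chosen models; it fixes a form of the condition in which both sides are
named morphisms. -/
lemma isUniversalCopairing_iff (ω : 𝟙_ (FdMod k H) ⟶ adjoint k H ⊗ comoduleEndObj k H B) :
    IsUniversalCopairing (internalHoms k H B) (adjointWedge k H) (comoduleEndWedge k H B) ω ↔
      ∀ (X : FdMod k H) (M : FdMod k B), ω ≫ copairingTest X M = copairingTarget X M :=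
  Iff.rfl

lemma lid_contractLeft_assoc {V W : Type u} [AddCommGroup V] [Module k V] [FiniteDimensional k V]
    [AddCommGroup W] [Module k W] (f : Module.Dual k V) (t : V ⊗[k] W) :
    TensorProduct.lid k W (TensorProduct.map (contractLeft k V) LinearMap.id
      ((TensorProduct.assoc k (Module.Dual k V) V W).symm (f ⊗ₜ t))) =
      tensorEquivDualHom k V W t f := by
  induction t with
  | zero => simp
  | add s t hs ht => simp only [TensorProduct.tmul_add, map_add, LinearMap.add_apply, hs, ht]
  | tmul a b => simp

lemma copairingMap_apply {E E' : FdMod k H} (ω : 𝟙_ (FdMod k H) ⟶ E ⊗ E')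
    (f : Module.Dual k E) :
    (copairingMap ω).hom f = tensorEquivDualHom k E E' (ω.hom (1 : k) : E ⊗[k] E') f :=
  lid_contractLeft_assoc f _

/-- The underlying map of `copairingMap ω` is `θ_B` composed with the transpose of the antipode,
which is bijective. -/
lemma isIso_copairingMap_iff {s : H ⊗[k] comoduleEnd k H B}
    (hs : evalEnd s = antipodeLeft B ∘ₗ conjK k H B)
    (ω : 𝟙_ (FdMod k H) ⟶ adjoint k H ⊗ comoduleEndObj k H B) (hω : ω.hom (1 : k) = s) :
    IsIso (copairingMap ω) ↔ IsFactorizableComoduleAlgebra k H B := by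
  rw [FdMod.isIso_iff_bijective]
  have h1 : ∀ f : Module.Dual k H, (copairingMap ω).hom f =
      theta k H B (f ∘ₗ HopfAlgebra.antipode k) := by
    intro f
    refine (copairingMap_apply ω f).trans ?_
    rw [hω]
    exact theta_comp_antipode hs f
  let S := LinearEquiv.ofBijective _ (antipode_bijective k H)
  have h2 : ((copairingMap ω).hom : Module.Dual k H → comoduleEnd k H B) =
      theta k H B ∘ S.dualMap := funext h1
  exact (congrArg Function.Bijective h2).to_iff.trans
    (Function.Bijective.of_comp_iff _ S.dualMap.bijective)

variable (k H B) in
/-- The nondegeneracy of the category of `B`-modules is equivalent to the factorizability of `B`. -/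
lemma isNondegenerateModuleCategory_iff_isFactorizable :
    IsNondegenerateModuleCategory (FdMod k H) (FdMod k B) ↔
      IsFactorizableComoduleAlgebra k H B := by
  rw [isNondegenerateModuleCategory_iff (internalHoms k H B) (adjointWedge k H)
    (comoduleEndWedge k H B) (adjointWedgeIsLimit k H) (comoduleEndWedgeIsLimit k H B)]
  constructor
  · rintro ⟨ω, hω, hiso⟩
    refine (isIso_copairingMap_iff (evalEnd_eq_of_copairingTest ?_) ω rfl).1 hiso
    exact LinearMap.congr_fun (congrArg Hom.hom
      ((isUniversalCopairing_iff ω).1 hω (reg k H) (reg k B))) (1 : k)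
  · intro hfact
    obtain ⟨s, hs⟩ := exists_evalEnd_eq k H B
    have htest := copairingTest_eq_target hs
    -- The map `c ↦ c s` is `H`-linear because the injective test morphism at the regular pair
    -- carries it to `copairingTarget`, which is a morphism.
    let ω : 𝟙_ (FdMod k H) ⟶ adjoint k H ⊗ comoduleEndObj k H B :=
      homOfInjective (copairingTest (reg k H) (reg k B)) copairingTest_reg_injective
        (copairingTarget (reg k H) (reg k B))
        (LinearMap.toSpanSingleton k (H ⊗[k] comoduleEnd k H B) s)
        (LinearMap.congr_fun (f := (copairingTest (reg k H) (reg k B)).hom ∘ₗ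
            LinearMap.toSpanSingleton k (H ⊗[k] comoduleEnd k H B) s)
          (LinearMap.ext_ring ((congrArg _ (one_smul k s)).trans (htest _ _))))
    have hω : ω.hom (1 : k) = s := one_smul k s
    exact ⟨ω, (isUniversalCopairing_iff ω).2 fun X M => hom_ext (LinearMap.ext_ring
      ((congrArg (copairingTest X M).hom hω).trans (htest X M))),
      (isIso_copairingMap_iff hs ω hω).2 hfact⟩

end FdMod

theorem theorem5 {k : Type u} [Field k] [IsAlgClosed k]
    {H : Type u} [Ring H] [HopfAlgebra k H] [FiniteDimensional k H]
    [QuasitriangularHopfAlgebra k H]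
    {B : Type u} [Ring B] [Algebra k B] [FiniteDimensional k B] [LeftComoduleAlgebra k H B]
    [QuasitriangularComoduleAlgebra k H B]
    (hex : IsExactModuleCategory (FdMod k H) (FdMod k B))
    (hind : IsIndecomposableModuleCategory (FdMod k H) (FdMod k B) k) :
    IsNondegenerateModuleCategory (FdMod k H) (FdMod k B) ↔
      IsFactorizableComoduleAlgebra k H B :=
  FdMod.isNondegenerateModuleCategory_iff_isFactorizable k H B
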